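/- Let $C_1, C_2$ be two CSS codes with binary parity-check matrices $H_{x_1}\in\mathbb F_2^{m_2\times n_A}$, $H_{z_1}\in\mathbb F_2^{m_1\times n_A}$, $H_{x_2}\in\mathbb F_2^{m_4\times n_B}$, $H_{z_2}\in\mathbb F_2^{m_3\times n_B}$ (so $H_{x_i}H_{z_i}^T=0$). The 4D XYZ product code has qubits in five blocks $A,B,C,D,E$ of sizes $m_1m_4,\ m_1m_3,\ n_An_B,\ m_2m_4,\ m_2m_3$, and its stabilizer group $\mathcal S$ is generated by the rows of $$\begin{bmatrix} X^{(I_{m_1}\otimes H_{x_2}^T)} & Y^{(I_{m_1}\otimes H_{z_2}^T)} & Z^{(H_{z_1}\otimes I_{n_B})} & I & I\\ Y^{(H_{z_1}^T\otimes I_{m_4})} & I & X^{(I_{n_A}\otimes H_{x_2})} & Z^{(H_{x_1}^T\otimes I_{m_4})} & I\\ I & Z^{(H_{z_1}^T\otimes I_{m_3})} & X^{(I_{n_A}\otimes H_{z_2})} & I & Y^{(H_{x_1}^T\otimes I_{m_3})}\\ I & I & Z^{(H_{x_1}\otimes I_{n_B})} & Y^{(I_{m_2}\otimes H_{x_2}^T)}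 & X^{(I_{m_2}\otimes H_{z_2}^T)}\end{bmatrix},$$ where $P^{(H)}$ (and $P(v)$ for a vector $v$) places the Pauli operator $P$ at the positions of the ones. A logical operator is a Pauli operator that commutes with $\mathcal S$ and is not in $\mathcal S$, even up to a phase $\pm1,\pm i$. Put $K_1=\ker[H_{z_1}^T,H_{x_1}^T]$, $K_2=\ker[H_{x_2}^T,H_{z_2}^T]$, $\kappa_i=\ker\begin{bmatrix}H_{x_i}\\H_{z_i}\end{bmatrix}$, and let $W_A,W_B,W_1,W_2$ be arbitrary linear complements of $\mathrm{Im}[H_{x_1}^T,H_{z_1}^T]\subseteq\mathbb F_2^{n_A}$, $\mathrm{Im}[H_{x_2}^T,H_{z_2}^T]\subseteq\mathbb F_2^{n_B}$, $\mathrm{Im}\begin{bmatrix}H_{z_1}\\H_{x_1}\end{bmatrix}\subseteq\mathbb F_2^{m_1+m_2}$, $\mathrm{Im}\begin{bmatrix}H_{x_2}\\H_{z_2}\end{bmatrix}\subseteq\mathbb F_2^{m_4+m_3}$, respectively. Let $\pi(u_1,u_2,v_1,v_2)$ denote the vector in $\mathbb F_2^{m_1+m_2}\otimes\mathbb F_2^{m_4+m_3}$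 whose blocks in $\mathbb F_2^{m_1}\otimes\mathbb F_2^{m_4}$, $\mathbb F_2^{m_1}\otimes\mathbb F_2^{m_3}$, $\mathbb F_2^{m_2}\otimes\mathbb F_2^{m_4}$, $\mathbb F_2^{m_2}\otimes\mathbb F_2^{m_3}$ are $u_1,u_2,v_1,v_2$. Call $W_1$ (resp. $W_2$) split if it is the direct sum of a subspace of $\mathbb F_2^{m_1}$ and one of $\mathbb F_2^{m_2}$ (resp. of $\mathbb F_2^{m_4}$ and of $\mathbb F_2^{m_3}$); split complements exist. First type: for nonzero $r\in\kappa_1\otimes W_B$ and nonzero $w\in W_A\otimes\kappa_2$, the operators $X_L=[I\ I\ X(r)\ I\ I]$ and $Z_L=[I\ I\ Z(w)\ I\ I]$ are logical operators. Second type: let $X_{L_2}=[X(a_1)\ I\ I\ Y(b_1)\ I]$, $X_{L_3}=[I\ Y(a_2)\ I\ I\ X(b_2)]$, $Z_{L_2}=[Y(c_1)\ Z(d_1)\ I\ I\ I]$, $Z_{L_3}=[I\ I\ I\ Z(c_2)\ Y(d_2)]$ with $\pi(a_1,a_2,b_1,b_2)\in K_1\otimes W_2$ and $\pi(c_1,d_1,c_2,d_2)\in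 W_1\otimes K_2$. These four operators commute with $\mathcal S$; $X_{L_2}X_{L_3}$ is a logical operator if $(a_1,a_2,b_1,b_2)\ne0$, and $Z_{L_2}Z_{L_3}$ is one if $(c_1,d_1,c_2,d_2)\neq0$. If $W_2$ is split, then $X_{L_2}$ is a logical operator if $(a_1,b_1)\neq 0$ and $X_{L_3}$ is one if $(a_2,b_2)\ne0$; if $W_1$ is split, then $Z_{L_2}$ is one if $(c_1,d_1)\neq0$ and $Z_{L_3}$ is one if $(c_2,d_2)\neq0$. Completeness: a Pauli operator is a logical operator if and only if, up to a phase and an element of $\mathcal S$, it is a product $X_LZ_L(X_{L_2}X_{L_3})(Z_{L_2}Z_{L_3})$ of operators of these forms whose vectors are not all zero. Number of pairs: let $k_1=\dim\kappa_1\dim\kappa_2$ and $k_2=\dim K_1\dim K_2$. There are $k_1$ pairs $(X_L,Z_L)$ of logical operators of the first type and $k_2$ pairs $(X_{L_2}X_{L_3},Z_{L_2}Z_{L_3})$ of the second type, such that the two operators of each pair anticommute and every other two of these $2(k_1+k_2)$ operators commute. In the pairs of the second type, one of $X_{L_2},X_{L_3}$ is trivial if $W_2$ is split, and one of $Z_{L_2},Z_{L_3}$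 is trivial if $W_1$ is split. The group $\mathcal S$ is Abelian and does not contain $-1$, and the code has dimension (number of qubits minus number of independent stabilizer generators) $$k_1+k_2=(n_A-m_1-m_2)(n_B-m_3-m_4)+\dim(K_1\otimes\kappa_2)+\dim(\kappa_1\otimes K_2).$$ -/

import Mathlib

open scoped Kronecker

noncomputable section

/-! ### Pauli operators on a finite register of qubits -/

/-- The four single-qubit Pauli labels. -/
inductive Pauli1 where
  | I | X | Y | Z

/-- The `2 × 2` complex matrix of a single-qubit Pauli operator. -/
def Pauli1.mat : Pauli1 → Matrix (Fin 2) (Fin 2) ℂ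
  | .I => 1
  | .X => !![0, 1; 1, 0]
  | .Y => !![0, -Complex.I; Complex.I, 0]
  | .Z => !![1, 0; 0, -1]

theorem Pauli1.mat_mul_self (P : Pauli1) : P.mat * P.mat = 1 := by
  cases P <;> simp [Pauli1.mat, Matrix.one_fin_two]

/-- Operators on the Hilbert space `(ℂ²)^{⊗ Q}`, written in the computational basis `Q → Fin 2`. -/
abbrev QOp (Q : Type) [Fintype Q] : Type := Matrix (Q → Fin 2) (Q → Fin 2) ℂ

/-- The tensor product of the single-qubit Pauli operators `s q`, `q ∈ Q`. -/
def pauliMatrix {Q : Type} [Fintype Q] (s : Q → Pauli1) : QOp Q :=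
  Matrix.of fun x y => ∏ q, (s q).mat (x q) (y q)

theorem pauliMatrix_mul_self {Q : Type} [Fintype Q] [DecidableEq Q] (s : Q → Pauli1) :
    pauliMatrix s * pauliMatrix s = 1 := by
  ext x y
  have h : ∀ q, ∑ z, (s q).mat (x q) z * (s q).mat z (y q) = if x q = y q then 1 else 0 := by
    intro q
    rw [← Matrix.mul_apply, Pauli1.mat_mul_self, Matrix.one_apply]
  simp only [Matrix.mul_apply, pauliMatrix, Matrix.of_apply, ← Finset.prod_mul_distrib]
  rw [← Fintype.piFinset_univ,
    ← Finset.prod_univ_sum (fun _ => Finset.univ)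
      (fun q z => (s q).mat (x q) z * (s q).mat z (y q))]
  simp only [h, Matrix.one_apply, Finset.prod_ite_zero, Finset.prod_const_one, funext_iff,
    Finset.mem_univ, true_implies]

/-- The Pauli string `s` as an invertible operator. -/
def pauliOp {Q : Type} [Fintype Q] [DecidableEq Q] (s : Q → Pauli1) : (QOp Q)ˣ :=
  ⟨pauliMatrix s, pauliMatrix s, pauliMatrix_mul_self s, pauliMatrix_mul_self s⟩

/-- The scalar operator `i`. -/
def phase (Q : Type) [Fintype Q] [DecidableEq Q] : (QOp Q)ˣ :=
  Units.map (algebraMap ℂ (QOp Q)).toMonoidHom (Units.mk0 Complex.I Complex.I_ne_zero)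

/-- The Pauli group on the qubits `Q`: all Pauli strings with phases `±1, ±i`. -/
def pauliGroup (Q : Type) [Fintype Q] [DecidableEq Q] : Subgroup (QOp Q)ˣ :=
  Subgroup.closure ({phase Q} ∪ Set.range pauliOp)

/-- `S` is the stabilizer group of an `[[n, k]]` stabilizer code on the qubits `Q`: a commutative
group of Pauli operators not containing `-1`, generated by `n - k` independent elements, where `n`
is the number of qubits. -/
structure IsStabilizerCode {Q : Type} [Fintype Q] [DecidableEq Q]
    (S : Subgroup (QOp Q)ˣ) (k : ℕ) : Prop where
  le_pauliGroup : S ≤ pauliGroup Q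
  commute : ∀ g ∈ S, ∀ h ∈ S, Commute g h
  neg_one_notMem : (-1 : (QOp Q)ˣ) ∉ S
  exists_generators : ∃ r : ℕ, r + k = Fintype.card Q ∧ ∃ g : Fin r → (QOp Q)ˣ,
    (∀ i, g i ∉ Subgroup.closure (g '' {j | j ≠ i})) ∧ Subgroup.closure (Set.range g) = S

/-- `P` is a logical operator for the stabilizer group `S`: a Pauli operator which commutes with
every element of `S` and is not in `S`, not even up to a phase. -/
structure IsLogical {Q : Type} [Fintype Q] [DecidableEq Q]
    (S : Subgroup (QOp Q)ˣ) (P : (QOp Q)ˣ) : Prop where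
  mem_pauliGroup : P ∈ pauliGroup Q
  commute : ∀ g ∈ S, Commute g P
  notMem : ∀ n : ℕ, phase Q ^ n * P ∉ S

/-- `P(v)`: the Pauli `P` at the positions where the binary vector `v` is `1`, identity
elsewhere. -/
def pauliVec {ι : Type} (P : Pauli1) (v : ι → ZMod 2) : ι → Pauli1 :=
  fun i => if v i = 1 then P else .I

/-! ### CSS codes and tensor products of binary spaces -/

/-- A CSS code, given by an `X`-type and a `Z`-type binary parity-check matrix. -/
structure CSSCode (mx mz n : ℕ) where
  Hx : Matrix (Fin mx) (Fin n) (ZMod 2)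
  Hz : Matrix (Fin mz) (Fin n) (ZMod 2)
  comm : Hx * Hz.transpose = 0

namespace CSSCode

variable {mx mz n : ℕ} (C : CSSCode mx mz n)

/-- `ker [Hx; Hz]` -/
def ker : Submodule (ZMod 2) (Fin n → ZMod 2) :=
  LinearMap.ker (Matrix.fromRows C.Hx C.Hz).mulVecLin

/-- `Im [Hxᵀ, Hzᵀ]` -/
def imT : Submodule (ZMod 2) (Fin n → ZMod 2) :=
  LinearMap.range (Matrix.fromCols C.Hx.transpose C.Hz.transpose).mulVecLin

/-- `ker [Hzᵀ, Hxᵀ]` -/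
def kerTZX : Submodule (ZMod 2) (Fin mz ⊕ Fin mx → ZMod 2) :=
  LinearMap.ker (Matrix.fromCols C.Hz.transpose C.Hx.transpose).mulVecLin

/-- `Im [Hz; Hx]` -/
def imZX : Submodule (ZMod 2) (Fin mz ⊕ Fin mx → ZMod 2) :=
  LinearMap.range (Matrix.fromRows C.Hz C.Hx).mulVecLin

/-- `ker [Hxᵀ, Hzᵀ]` -/
def kerTXZ : Submodule (ZMod 2) (Fin mx ⊕ Fin mz → ZMod 2) :=
  LinearMap.ker (Matrix.fromCols C.Hx.transpose C.Hz.transpose).mulVecLin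

/-- `Im [Hx; Hz]` -/
def imXZ : Submodule (ZMod 2) (Fin mx ⊕ Fin mz → ZMod 2) :=
  LinearMap.range (Matrix.fromRows C.Hx C.Hz).mulVecLin

end CSSCode

/-- The tensor product `U ⊗ V` of two spaces of binary vectors, inside the space of vectors
indexed by pairs. -/
def tensorSub {ι κ : Type} (U : Submodule (ZMod 2) (ι → ZMod 2))
    (V : Submodule (ZMod 2) (κ → ZMod 2)) : Submodule (ZMod 2) (ι × κ → ZMod 2) :=
  Submodule.span (ZMod 2) {r | ∃ x ∈ U, ∃ y ∈ V, r = fun p => x p.1 * y p.2}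

/-- A space of vectors indexed by `α ⊕ β` which is the direct sum of a space of vectors supported
on `α` and a space of vectors supported on `β`. -/
def IsBlockAdapted {α β : Type} (W : Submodule (ZMod 2) (α ⊕ β → ZMod 2)) : Prop :=
  ∀ y ∈ W, Sum.elim (fun i => y (Sum.inl i)) (fun _ => 0) ∈ W

/-- The rearrangement `π` of four blocks into one vector indexed by pairs. -/
def piPerm {α β γ δ : Type} (u₁ : α × γ → ZMod 2) (u₂ : α × δ → ZMod 2)
    (v₁ : β × γ → ZMod 2) (v₂ : β × δ → ZMod 2) : (α ⊕ β) × (γ ⊕ δ) → ZMod 2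
  | (.inl i, .inl j) => u₁ (i, j)
  | (.inl i, .inr j) => u₂ (i, j)
  | (.inr i, .inl j) => v₁ (i, j)
  | (.inr i, .inr j) => v₂ (i, j)

/-! ### The 4D XYZ product code -/

/-- The qubits, in five blocks `A`, `B`, `C`, `D`, `E`. -/
abbrev Qubit (m₁ m₂ m₃ m₄ nA nB : ℕ) : Type :=
  (Fin m₁ × Fin m₄) ⊕ (Fin m₁ × Fin m₃) ⊕ (Fin nA × Fin nB) ⊕
    (Fin m₂ × Fin m₄) ⊕ (Fin m₂ × Fin m₃)

section XYZ

variable {m₁ m₂ m₃ m₄ nA nB : ℕ}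

/-- The operator `[A B C D E]` with prescribed Pauli strings on the five blocks. -/
def blocks (a : Fin m₁ × Fin m₄ → Pauli1) (b : Fin m₁ × Fin m₃ → Pauli1)
    (c : Fin nA × Fin nB → Pauli1) (d : Fin m₂ × Fin m₄ → Pauli1)
    (e : Fin m₂ × Fin m₃ → Pauli1) : (QOp (Qubit m₁ m₂ m₃ m₄ nA nB))ˣ :=
  pauliOp (Sum.elim a (Sum.elim b (Sum.elim c (Sum.elim d e))))

/-- The identity on a block. -/
abbrev idBlock {ι : Type} : ι → Pauli1 := fun _ => Pauli1.I

variable (C₁ : CSSCode m₂ m₁ nA) (C₂ : CSSCode m₄ m₃ nB)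

/-- The stabilizer generators in `S`. -/
def genS (i : Fin m₁ × Fin nB) : (QOp (Qubit m₁ m₂ m₃ m₄ nA nB))ˣ :=
  blocks
    (pauliVec .X (((1 : Matrix (Fin m₁) (Fin m₁) (ZMod 2)) ⊗ₖ C₂.Hx.transpose) i))
    (pauliVec .Y (((1 : Matrix (Fin m₁) (Fin m₁) (ZMod 2)) ⊗ₖ C₂.Hz.transpose) i))
    (pauliVec .Z ((C₁.Hz ⊗ₖ (1 : Matrix (Fin nB) (Fin nB) (ZMod 2))) i))
    idBlock
    idBlock

/-- The stabilizer generators in `T`. -/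
def genT (i : Fin nA × Fin m₄) : (QOp (Qubit m₁ m₂ m₃ m₄ nA nB))ˣ :=
  blocks
    (pauliVec .Y ((C₁.Hz.transpose ⊗ₖ (1 : Matrix (Fin m₄) (Fin m₄) (ZMod 2))) i))
    idBlock
    (pauliVec .X (((1 : Matrix (Fin nA) (Fin nA) (ZMod 2)) ⊗ₖ C₂.Hx) i))
    (pauliVec .Z ((C₁.Hx.transpose ⊗ₖ (1 : Matrix (Fin m₄) (Fin m₄) (ZMod 2))) i))
    idBlock

/-- The stabilizer generators in `U`. -/
def genU (i : Fin nA × Fin m₃) : (QOp (Qubit m₁ m₂ m₃ m₄ nA nB))ˣ :=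
  blocks
    idBlock
    (pauliVec .Z ((C₁.Hz.transpose ⊗ₖ (1 : Matrix (Fin m₃) (Fin m₃) (ZMod 2))) i))
    (pauliVec .X (((1 : Matrix (Fin nA) (Fin nA) (ZMod 2)) ⊗ₖ C₂.Hz) i))
    idBlock
    (pauliVec .Y ((C₁.Hx.transpose ⊗ₖ (1 : Matrix (Fin m₃) (Fin m₃) (ZMod 2))) i))

/-- The stabilizer generators in `V`. -/
def genV (i : Fin m₂ × Fin nB) : (QOp (Qubit m₁ m₂ m₃ m₄ nA nB))ˣ :=
  blocks
    idBlock
    idBlock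
    (pauliVec .Z ((C₁.Hx ⊗ₖ (1 : Matrix (Fin nB) (Fin nB) (ZMod 2))) i))
    (pauliVec .Y (((1 : Matrix (Fin m₂) (Fin m₂) (ZMod 2)) ⊗ₖ C₂.Hx.transpose) i))
    (pauliVec .X (((1 : Matrix (Fin m₂) (Fin m₂) (ZMod 2)) ⊗ₖ C₂.Hz.transpose) i))

/-- The stabilizer group of the 4D XYZ product code of `C₁` and `C₂`. -/
def xyzStabilizer : Subgroup (QOp (Qubit m₁ m₂ m₃ m₄ nA nB))ˣ :=
  Subgroup.closure (Set.range (genS C₁ C₂) ∪ Set.range (genT C₁ C₂) ∪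
    Set.range (genU C₁ C₂) ∪ Set.range (genV C₁ C₂))

/-- `[I I X(r) I I]` -/
def opXL (r : Fin nA × Fin nB → ZMod 2) : (QOp (Qubit m₁ m₂ m₃ m₄ nA nB))ˣ :=
  blocks idBlock idBlock (pauliVec .X r) idBlock idBlock

/-- `[I I Z(w) I I]` -/
def opZL (w : Fin nA × Fin nB → ZMod 2) : (QOp (Qubit m₁ m₂ m₃ m₄ nA nB))ˣ :=
  blocks idBlock idBlock (pauliVec .Z w) idBlock idBlock

/-- `[X(a₁) I I Y(b₁) I]` -/
def opXL2 (a₁ : Fin m₁ × Fin m₄ → ZMod 2) (b₁ : Fin m₂ × Fin m₄ → ZMod 2) :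
    (QOp (Qubit m₁ m₂ m₃ m₄ nA nB))ˣ :=
  blocks (pauliVec .X a₁) idBlock idBlock (pauliVec .Y b₁) idBlock

/-- `[I Y(a₂) I I X(b₂)]` -/
def opXL3 (a₂ : Fin m₁ × Fin m₃ → ZMod 2) (b₂ : Fin m₂ × Fin m₃ → ZMod 2) :
    (QOp (Qubit m₁ m₂ m₃ m₄ nA nB))ˣ :=
  blocks idBlock (pauliVec .Y a₂) idBlock idBlock (pauliVec .X b₂)

/-- `[Y(c₁) Z(d₁) I I I]` -/
def opZL2 (c₁ : Fin m₁ × Fin m₄ → ZMod 2) (d₁ : Fin m₁ × Fin m₃ → ZMod 2) :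
    (QOp (Qubit m₁ m₂ m₃ m₄ nA nB))ˣ :=
  blocks (pauliVec .Y c₁) (pauliVec .Z d₁) idBlock idBlock idBlock

/-- `[I I I Z(c₂) Y(d₂)]` -/
def opZL3 (c₂ : Fin m₂ × Fin m₄ → ZMod 2) (d₂ : Fin m₂ × Fin m₃ → ZMod 2) :
    (QOp (Qubit m₁ m₂ m₃ m₄ nA nB))ˣ :=
  blocks idBlock idBlock idBlock (pauliVec .Z c₂) (pauliVec .Y d₂)

end XYZ

end

/-! Each qubit meets only two Pauli labels. On the blocks `A`, ..., `E` the generators `genS`,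
`genV` use X, Y, Z, Y, X, and `genT`, `genU` use Y, Z, X, Z, Y. The two labels differ at every
qubit, so they anticommute there and generate the one-qubit Pauli group up to phases. Hence every
Pauli operator is, up to a power of `i`, uniquely a product of a left string `v` and a right string
`w`, and the signs from exchanging left and right strings are given by the dot product. In this
frame the code is a CSS code, and commutation and membership become linear algebra over the field
with two elements (`IsFrameStabilizer.isLogical_iff`, `isFrameStabilizer_xyz`).

That CSS code is the hypergraph product of `H = [Hz₁; Hx₁]` and `G = [Hx₂; Hz₂]`: blocks `A`, `B`,
`D`, `E` together form one matrix `X`, block `C` a matrix `Y`, the left checks are `(U Gᵀ, Hᵀ U)`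
and the right checks `(H T, T G)`. A left string commutes with the stabilizer iff `Hᵀ X + Y Gᵀ = 0`.
An explicit Künneth argument (`exists_boundary_add_of_cycle`, `eq_zero_of_boundary_mem`) shows that,
modulo left checks, such cycles are exactly the elements of `K₁ ⊗ W₂` and `W_A ⊗ κ₂`. Transposition
gives `W₁ ⊗ K₂` and `κ₁ ⊗ W_B` on the right. This yields the logical operators and completeness.

For the pairs, `ker Hᵀ` is the annihilator of the image of `H`, hence dual to any complement of that
image (`exists_dual_bases`); tensor products of dual families are dual. The dimension follows from
the ranks of the two check maps, whose kernels are tensor products of kernels. -/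

/-! ### Pauli strings in a frame of two labels per qubit, and stabilizer groups that are CSS in a
frame. -/

section Frames

variable {Q : Type} [Fintype Q]

/-- The tensor product of one-qubit operators. -/
def tensorMat (M : Q → Matrix (Fin 2) (Fin 2) ℂ) : QOp Q :=
  Matrix.of fun x y => ∏ q, M q (x q) (y q)

theorem tensorMat_mul [DecidableEq Q] (M N : Q → Matrix (Fin 2) (Fin 2) ℂ) :
    tensorMat M * tensorMat N = tensorMat fun q => M q * N q := by
  ext x y
  simp only [Matrix.mul_apply, tensorMat, Matrix.of_apply, ← Finset.prod_mul_distrib]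
  rw [← Fintype.piFinset_univ,
    ← Finset.prod_univ_sum (fun _ => Finset.univ) (fun q z => M q (x q) z * N q z (y q))]

theorem tensorMat_smul (c : Q → ℂ) (M : Q → Matrix (Fin 2) (Fin 2) ℂ) :
    tensorMat (fun q => c q • M q) = (∏ q, c q) • tensorMat M := by
  ext x y
  simp [tensorMat, Finset.prod_mul_distrib]

/-- The label `P` if the bit is `1`, and `I` otherwise. -/
def Pauli1.bit (P : Pauli1) (a : ZMod 2) : Pauli1 := if a = 1 then P else .I

theorem zmod_two_cases (a : ZMod 2) : a = 0 ∨ a = 1 := by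
  revert a; decide

theorem Pauli1.bit_mul_bit (P : Pauli1) (a b : ZMod 2) :
    (P.bit a).mat * (P.bit b).mat = (P.bit (a + b)).mat := by
  have h : (1 : ZMod 2) + 1 = 0 := rfl
  rcases zmod_two_cases a with rfl | rfl <;> rcases zmod_two_cases b with rfl | rfl <;>
    simp [Pauli1.bit, h, Pauli1.mat_mul_self] <;> simp [Pauli1.mat]

theorem Pauli1.bit_mul_comm {P R : Pauli1} (hP : P ≠ .I) (hR : R ≠ .I) (hPR : P ≠ R)
    (a b : ZMod 2) : (P.bit a).mat * (R.bit b).mat =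
      (-1 : ℂ) ^ (a * b).val • ((R.bit b).mat * (P.bit a).mat) := by
  rcases zmod_two_cases a with rfl | rfl <;> rcases zmod_two_cases b with rfl | rfl <;>
    simp [Pauli1.bit, ZMod.val_one] <;> cases P <;> cases R <;> simp_all [Pauli1.mat]

/-- Two distinct nontrivial Paulis generate the one-qubit Pauli group up to phases, since their
product is the third one times `i` or `-i`. -/
theorem Pauli1.exists_bit_mul_bit {P R : Pauli1} (hP : P ≠ .I) (hR : R ≠ .I) (hPR : P ≠ R)
    (s : Pauli1) : ∃ (n : ℕ) (a b : ZMod 2),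
      s.mat = Complex.I ^ n • ((P.bit a).mat * (R.bit b).mat) := by
  by_cases h0 : s = .I
  · exact ⟨0, 0, 0, by simp [h0, Pauli1.bit, Pauli1.mat]⟩
  by_cases h1 : s = P
  · exact ⟨0, 1, 0, by simp [h1, Pauli1.bit]; simp [Pauli1.mat]⟩
  by_cases h2 : s = R
  · exact ⟨0, 0, 1, by simp [h2, Pauli1.bit]; simp [Pauli1.mat]⟩
  -- The third Pauli is `i P R` or `-i P R = i³ P R`, according to the cyclic order of `P` and `R`;
  -- hence the exponents 1 and 3.
  by_cases h3 : s.mat = Complex.I ^ 1 • ((P.bit 1).mat * (R.bit 1).mat)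
  · exact ⟨1, 1, 1, h3⟩
  refine ⟨3, 1, 1, ?_⟩
  revert h3
  cases s <;> cases P <;> cases R <;> first
    | contradiction
    | (intro h3; simp [Pauli1.mat, Pauli1.bit, pow_succ] at h3 ⊢)

theorem neg_one_pow_val_sum {ι : Type} (s : Finset ι) (a : ι → ZMod 2) :
    ∏ q ∈ s, (-1 : ℂ) ^ (a q).val = (-1) ^ (∑ q ∈ s, a q).val := by
  classical
  have h : ∀ b c : ZMod 2, (-1 : ℂ) ^ (b + c).val = (-1) ^ b.val * (-1) ^ c.val := by
    have h2 : (1 : ZMod 2) + 1 = 0 := rfl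
    intro b c
    rcases zmod_two_cases b with rfl | rfl <;> rcases zmod_two_cases c with rfl | rfl <;>
      simp [h2, ZMod.val_one]
  induction s using Finset.induction_on with
  | empty => simp
  | insert i s hi ih => rw [Finset.prod_insert hi, Finset.sum_insert hi, h, ih]

variable [DecidableEq Q]

theorem coe_phase_pow (n : ℕ) :
    ((phase Q ^ n : (QOp Q)ˣ) : QOp Q) = algebraMap ℂ (QOp Q) (Complex.I ^ n) := by
  simp [phase]

theorem coe_phase_pow_mul (n : ℕ) (A : (QOp Q)ˣ) :
    ((phase Q ^ n * A : (QOp Q)ˣ) : QOp Q) = Complex.I ^ n • (A : QOp Q) := by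
  rw [Units.val_mul, coe_phase_pow, ← Algebra.smul_def]

theorem phase_pow_commute (n : ℕ) (A : (QOp Q)ˣ) : Commute (phase Q ^ n) A := by
  refine Commute.pow_left ?_ n
  ext1
  simp only [Units.val_mul]
  exact Algebra.commutes _ _

theorem phase_sq : phase Q ^ 2 = -1 := by
  ext1
  rw [coe_phase_pow, Complex.I_sq]
  simp

theorem phase_pow_four : phase Q ^ 4 = 1 := by
  rw [show 4 = 2 * 2 from rfl, pow_mul, phase_sq]; simp

/-- Signs are written as `i ^ (2a)` with a bit `a`; since `-1 ≠ 1`, the bit can be read off. Every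
criterion for commutation below ends here. -/
theorem phase_pow_two_mul_val_eq_one {a : ZMod 2} (h : phase Q ^ (2 * a.val) = 1) : a = 0 := by
  rcases zmod_two_cases a with rfl | rfl
  · rfl
  · rw [ZMod.val_one, mul_one, phase_sq] at h
    have h1 := congrArg (fun A : (QOp Q)ˣ => (A : QOp Q) 0 0) h
    simp at h1
    norm_num at h1

/-- The Pauli string with label `f q` at the positions `q` where `v` is `1`. -/
def frameOp (f : Q → Pauli1) (v : Q → ZMod 2) : (QOp Q)ˣ :=
  pauliOp fun q => (f q).bit (v q)

theorem coe_frameOp (f : Q → Pauli1) (v : Q → ZMod 2) :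
    (frameOp f v : QOp Q) = tensorMat fun q => ((f q).bit (v q)).mat := rfl

/-- Only one label occurs at each qubit and it squares to the identity, so no phase appears: strings
of one type form a homomorphic image of the binary vectors. -/
theorem frameOp_add (f : Q → Pauli1) (v w : Q → ZMod 2) :
    frameOp f (v + w) = frameOp f v * frameOp f w := by
  ext1
  simp only [Units.val_mul, coe_frameOp, tensorMat_mul, Pauli1.bit_mul_bit, Pi.add_apply]

theorem frameOp_zero (f : Q → Pauli1) : frameOp f 0 = 1 := by
  have h := frameOp_add f 0 0
  rw [add_zero] at h
  exact (mul_eq_left.mp h.symm)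

theorem frameOp_commute_self (f : Q → Pauli1) (v w : Q → ZMod 2) :
    Commute (frameOp f v) (frameOp f w) := by
  rw [Commute, SemiconjBy, ← frameOp_add, ← frameOp_add, add_comm]

theorem binary_add_self {ι : Type} (v : ι → ZMod 2) : v + v = 0 :=
  funext fun _ => CharTwo.add_self_eq_zero _

theorem frameOp_inv (f : Q → Pauli1) (v : Q → ZMod 2) : (frameOp f v)⁻¹ = frameOp f v := by
  rw [inv_eq_iff_mul_eq_one, ← frameOp_add, binary_add_self, frameOp_zero]

theorem frameOp_mem_pauliGroup (f : Q → Pauli1) (v : Q → ZMod 2) :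
    frameOp f v ∈ pauliGroup Q :=
  Subgroup.subset_closure (Or.inr ⟨_, rfl⟩)

theorem phase_pow_mem_pauliGroup (n : ℕ) : phase Q ^ n ∈ pauliGroup Q :=
  have h : phase Q ∈ pauliGroup Q :=
    Subgroup.subset_closure (Set.mem_union_left _ (Set.mem_singleton _))
  pow_mem h n

/-- At each qubit, `f` and `g` name two different nontrivial Pauli operators. -/
def IsFrame (f g : Q → Pauli1) : Prop := ∀ q, f q ≠ .I ∧ g q ≠ .I ∧ f q ≠ g q

variable {f g : Q → Pauli1}

theorem IsFrame.symm {ι : Type} {f g : ι → Pauli1} (h : IsFrame f g) : IsFrame g f :=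
  fun q => ⟨(h q).2.1, (h q).1, (h q).2.2.symm⟩

/-- One sign arises at each qubit where both strings are nontrivial, and the dot product counts
these qubits modulo 2. -/
theorem IsFrame.mul_comm (h : IsFrame f g) (v w : Q → ZMod 2) :
    frameOp f v * frameOp g w = phase Q ^ (2 * (v ⬝ᵥ w).val) * (frameOp g w * frameOp f v) := by
  ext1
  rw [coe_phase_pow_mul, pow_mul, Complex.I_sq]
  simp only [Units.val_mul, coe_frameOp, tensorMat_mul]
  rw [dotProduct, ← neg_one_pow_val_sum, ← tensorMat_smul]
  congr 1
  funext q
  exact Pauli1.bit_mul_comm (h q).1 (h q).2.1 (h q).2.2 _ _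

theorem IsFrame.commute_iff (h : IsFrame f g) (v w : Q → ZMod 2) :
    Commute (frameOp f v) (frameOp g w) ↔ v ⬝ᵥ w = 0 := by
  rw [Commute, SemiconjBy, h.mul_comm]
  constructor
  · intro h1
    exact phase_pow_two_mul_val_eq_one (mul_eq_right.mp h1)
  · intro h1
    simp [h1]

theorem IsFrame.exists_eq_of_mem_pauliGroup (h : IsFrame f g) {P : (QOp Q)ˣ}
    (hP : P ∈ pauliGroup Q) : ∃ n v w, P = phase Q ^ n * (frameOp f v * frameOp g w) := by
  -- The normal form survives products: moving the right string `w` past the left string `v'` costs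
  -- the sign of `w ⬝ᵥ v'`.
  have hmul : ∀ n v w n' v' w', ∃ N V W,
      phase Q ^ n * (frameOp f v * frameOp g w) * (phase Q ^ n' * (frameOp f v' * frameOp g w')) =
        phase Q ^ N * (frameOp f V * frameOp g W) := by
    intro n v w n' v' w'
    refine ⟨n + n' + 2 * (w ⬝ᵥ v').val, v + v', w + w', ?_⟩
    have h1 := h.symm.mul_comm w v'
    have c1 := (phase_pow_commute n' (frameOp f v * frameOp g w)).eq
    have c2 := (phase_pow_commute (2 * (w ⬝ᵥ v').val) (frameOp f v)).eq
    rw [frameOp_add, frameOp_add, pow_add, pow_add]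
    calc _ = phase Q ^ n * ((frameOp f v * frameOp g w * phase Q ^ n') *
          (frameOp f v' * frameOp g w')) := by group
      _ = phase Q ^ n * phase Q ^ n' * (frameOp f v * (frameOp g w * frameOp f v') *
          frameOp g w') := by rw [← c1]; group
      _ = phase Q ^ n * phase Q ^ n' * ((frameOp f v * phase Q ^ (2 * (w ⬝ᵥ v').val)) *
          (frameOp f v' * frameOp g w) * frameOp g w') := by rw [h1]; group
      _ = _ := by rw [← c2]; group
  induction hP using Subgroup.closure_induction with
  | one => exact ⟨0, 0, 0, by simp [frameOp_zero]⟩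
  | mem x hx =>
    rcases hx with hx | ⟨s, rfl⟩
    · rw [Set.mem_singleton_iff] at hx
      exact ⟨1, 0, 0, by simp [frameOp_zero, hx]⟩
    · choose n a b hs using fun q =>
        Pauli1.exists_bit_mul_bit (h q).1 (h q).2.1 (h q).2.2 (s q)
      refine ⟨∑ q, n q, a, b, ?_⟩
      ext1
      rw [coe_phase_pow_mul, ← Finset.prod_pow_eq_pow_sum]
      simp only [Units.val_mul, coe_frameOp, tensorMat_mul]
      rw [← tensorMat_smul]
      simp only [← hs]
      rfl
  | mul x y _ _ hx hy =>
    obtain ⟨n, v, w, rfl⟩ := hx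
    obtain ⟨n', v', w', rfl⟩ := hy
    exact hmul _ _ _ _ _ _
  | inv x _ hx =>
    obtain ⟨n, v, w, rfl⟩ := hx
    -- The phase has order dividing 4, so `3 * n` serves as a natural-number exponent for the
    -- inverse.
    have hn : (phase Q ^ n)⁻¹ = phase Q ^ (3 * n) := by
      rw [inv_eq_iff_mul_eq_one, ← pow_add, show n + 3 * n = 4 * n by ring, pow_mul,
        phase_pow_four, one_pow]
    rw [mul_inv_rev, mul_inv_rev, frameOp_inv, frameOp_inv, hn]
    -- The inverse has its factors in the opposite order; it is read as the product of the normal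
    -- forms with vectors `(0, w)` and `(v, 0)`.
    obtain ⟨N, V, W, e⟩ := hmul 0 0 w (3 * n) v 0
    refine ⟨N, V, W, ?_⟩
    rw [← e, frameOp_zero, frameOp_zero, (phase_pow_commute (3 * n) _).eq]
    simp [mul_assoc]

theorem phase_pow_two_mul_val_injective {a b : ZMod 2}
    (h : phase Q ^ (2 * a.val) = phase Q ^ (2 * b.val)) : a = b := by
  rcases zmod_two_cases a with rfl | rfl <;> rcases zmod_two_cases b with rfl | rfl
  · rfl
  · exact (phase_pow_two_mul_val_eq_one (h.symm.trans (by simp))).symm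
  · exact phase_pow_two_mul_val_eq_one (h.trans (by simp))
  · rfl

theorem IsFrame.mul_frameOp_right (h : IsFrame f g) (n : ℕ) (v w s : Q → ZMod 2) :
    phase Q ^ n * (frameOp f v * frameOp g w) * frameOp g s =
      phase Q ^ (2 * (v ⬝ᵥ s).val) *
        (frameOp g s * (phase Q ^ n * (frameOp f v * frameOp g w))) := by
  rw [← (phase_pow_commute n (frameOp g s)).left_comm, mul_assoc, mul_assoc,
    (frameOp_commute_self g w s).eq, ← mul_assoc (frameOp f v), h.mul_comm,
    (phase_pow_commute _ (phase Q ^ n)).left_comm]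
  simp only [mul_assoc]

theorem IsFrame.mul_frameOp_left (h : IsFrame f g) (n : ℕ) (v w s : Q → ZMod 2) :
    phase Q ^ n * (frameOp f v * frameOp g w) * frameOp f s =
      phase Q ^ (2 * (w ⬝ᵥ s).val) *
        (frameOp f s * (phase Q ^ n * (frameOp f v * frameOp g w))) := by
  rw [← (phase_pow_commute n (frameOp f s)).left_comm, mul_assoc, mul_assoc,
    h.symm.mul_comm, ← (phase_pow_commute _ (frameOp f v)).left_comm,
    (frameOp_commute_self f v s).left_comm,
    (phase_pow_commute _ (phase Q ^ n)).left_comm]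

/-- Uniqueness of the normal form. The sign from exchanging the operator with the right string at a
single qubit `q` is `v q`, and the left string there detects `w q`; once both vectors agree, the
phase must be trivial. -/
theorem IsFrame.eq_of_phase_mul_eq (h : IsFrame f g) {n : ℕ} {v v' w w' : Q → ZMod 2}
    (e : phase Q ^ n * (frameOp f v * frameOp g w) = frameOp f v' * frameOp g w') :
    phase Q ^ n = 1 ∧ v = v' ∧ w = w' := by
  have e' : phase Q ^ n * (frameOp f v * frameOp g w) =
      phase Q ^ 0 * (frameOp f v' * frameOp g w') := by rw [e, pow_zero, one_mul]
  have hv : v = v' := by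
    funext q
    have h1 := h.mul_frameOp_right n v w (Pi.single q 1)
    rw [e', h.mul_frameOp_right] at h1
    simpa using (phase_pow_two_mul_val_injective (mul_right_cancel h1)).symm
  have hw : w = w' := by
    funext q
    have h1 := h.mul_frameOp_left n v w (Pi.single q 1)
    rw [e', h.mul_frameOp_left] at h1
    simpa using (phase_pow_two_mul_val_injective (mul_right_cancel h1)).symm
  subst hv hw
  exact ⟨mul_eq_right.mp e, rfl, rfl⟩

theorem exists_phase_pow_mul_eq_one (n : ℕ) : phase Q ^ (3 * n) * phase Q ^ n = 1 := by
  rw [← pow_add, show 3 * n + n = 4 * n by ring, pow_mul, phase_pow_four, one_pow]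

/-- The group generated by the Pauli strings of type `f` and `g` on two orthogonal sets of
vectors. -/
theorem IsFrame.mem_closure_iff (h : IsFrame f g) {A B : Set (Q → ZMod 2)}
    (hAB : ∀ a ∈ A, ∀ b ∈ B, a ⬝ᵥ b = 0) (x : (QOp Q)ˣ) :
    x ∈ Subgroup.closure (frameOp f '' A ∪ frameOp g '' B) ↔
      ∃ v ∈ Submodule.span (ZMod 2) A, ∃ w ∈ Submodule.span (ZMod 2) B,
        x = frameOp f v * frameOp g w := by
  -- Orthogonality passes from the generating sets to their spans, so left and right factors commute
  -- and can be collected.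
  have hspan : ∀ v ∈ Submodule.span (ZMod 2) A, ∀ w ∈ Submodule.span (ZMod 2) B,
      Commute (frameOp f v) (frameOp g w) := by
    intro v hv w hw
    rw [h.commute_iff]
    induction hv using Submodule.span_induction with
    | zero => simp
    | add v v' _ _ hv hv' => rw [add_dotProduct, hv, hv', add_zero]
    | smul c v _ hv => rw [smul_dotProduct, hv, smul_zero]
    | mem v hv =>
      induction hw using Submodule.span_induction with
      | zero => simp
      | add w w' _ _ hw hw' => rw [dotProduct_add, hw, hw', add_zero]
      | smul c w _ hw => rw [dotProduct_smul, hw, smul_zero]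
      | mem w hw => exact hAB v hv w hw
  have hmem : ∀ {f : Q → Pauli1} {A : Set (Q → ZMod 2)} {G : Subgroup (QOp Q)ˣ},
      frameOp f '' A ⊆ G → ∀ v ∈ Submodule.span (ZMod 2) A, frameOp f v ∈ G := by
    intro f A G hA v hv
    induction hv using Submodule.span_induction with
    | zero => rw [frameOp_zero]; exact one_mem _
    | add v v' _ _ hv hv' => rw [frameOp_add]; exact mul_mem hv hv'
    | smul c v _ hv =>
      rcases zmod_two_cases c with rfl | rfl
      · rw [zero_smul, frameOp_zero]; exact one_mem _
      · rwa [one_smul]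
    | mem v hv => exact hA ⟨v, hv, rfl⟩
  constructor
  · intro hx
    induction hx using Subgroup.closure_induction with
    | one => exact ⟨0, zero_mem _, 0, zero_mem _, by simp [frameOp_zero]⟩
    | mem x hx =>
      rcases hx with ⟨v, hv, rfl⟩ | ⟨w, hw, rfl⟩
      · exact ⟨v, Submodule.subset_span hv, 0, zero_mem _, by simp [frameOp_zero]⟩
      · exact ⟨0, zero_mem _, w, Submodule.subset_span hw, by simp [frameOp_zero]⟩
    | mul x y _ _ hx hy =>
      obtain ⟨v, hv, w, hw, rfl⟩ := hx
      obtain ⟨v', hv', w', hw', rfl⟩ := hy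
      refine ⟨v + v', add_mem hv hv', w + w', add_mem hw hw', ?_⟩
      rw [frameOp_add, frameOp_add, mul_assoc, mul_assoc, (hspan v' hv' w hw).left_comm]
    | inv x _ hx =>
      obtain ⟨v, hv, w, hw, rfl⟩ := hx
      exact ⟨v, hv, w, hw, by rw [mul_inv_rev, frameOp_inv, frameOp_inv, (hspan v hv w hw).eq]⟩
  · rintro ⟨v, hv, w, hw, rfl⟩
    exact mul_mem
      (hmem (Set.subset_union_left.trans Subgroup.subset_closure) v hv)
      (hmem (Set.subset_union_right.trans Subgroup.subset_closure) w hw)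

/-- `S` is the group of the operators `f(v) g(w)` with `v ∈ V`, `w ∈ W`, where `V` and `W` are
orthogonal. -/
structure IsFrameStabilizer (f g : Q → Pauli1) (V W : Submodule (ZMod 2) (Q → ZMod 2))
    (S : Subgroup (QOp Q)ˣ) : Prop where
  isFrame : IsFrame f g
  orthogonal : ∀ v ∈ V, ∀ w ∈ W, v ⬝ᵥ w = 0
  mem_iff : ∀ x, x ∈ S ↔ ∃ v ∈ V, ∃ w ∈ W, x = frameOp f v * frameOp g w

namespace IsFrameStabilizer

variable {V W : Submodule (ZMod 2) (Q → ZMod 2)} {S : Subgroup (QOp Q)ˣ}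

theorem phase_mul_mem_iff (h : IsFrameStabilizer f g V W S) (n : ℕ) (v w : Q → ZMod 2) :
    phase Q ^ n * (frameOp f v * frameOp g w) ∈ S ↔ phase Q ^ n = 1 ∧ v ∈ V ∧ w ∈ W := by
  rw [h.mem_iff]
  constructor
  · rintro ⟨v', hv', w', hw', e⟩
    obtain ⟨e1, rfl, rfl⟩ := h.isFrame.eq_of_phase_mul_eq e
    exact ⟨e1, hv', hw'⟩
  · rintro ⟨e, hv, hw⟩
    exact ⟨v, hv, w, hw, by rw [e, one_mul]⟩

theorem commute_iff (h : IsFrameStabilizer f g V W S) (n : ℕ) (v w : Q → ZMod 2) :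
    (∀ x ∈ S, Commute x (phase Q ^ n * (frameOp f v * frameOp g w))) ↔
      (∀ u ∈ W, v ⬝ᵥ u = 0) ∧ ∀ u ∈ V, w ⬝ᵥ u = 0 := by
  have hr : ∀ u, Commute (frameOp g u) (phase Q ^ n * (frameOp f v * frameOp g w)) ↔
      v ⬝ᵥ u = 0 := by
    intro u
    rw [Commute.symm_iff, Commute, SemiconjBy, h.isFrame.mul_frameOp_right]
    exact ⟨fun e => phase_pow_two_mul_val_eq_one (mul_eq_right.mp e), fun e => by simp [e]⟩
  have hl : ∀ u, Commute (frameOp f u) (phase Q ^ n * (frameOp f v * frameOp g w)) ↔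
      w ⬝ᵥ u = 0 := by
    intro u
    rw [Commute.symm_iff, Commute, SemiconjBy, h.isFrame.mul_frameOp_left]
    exact ⟨fun e => phase_pow_two_mul_val_eq_one (mul_eq_right.mp e), fun e => by simp [e]⟩
  simp only [← hr, ← hl]
  constructor
  · intro hx
    refine ⟨fun u hu => hx _ ?_, fun u hu => hx _ ?_⟩
    · exact (h.mem_iff _).mpr ⟨0, zero_mem _, u, hu, by simp [frameOp_zero]⟩
    · exact (h.mem_iff _).mpr ⟨u, hu, 0, zero_mem _, by simp [frameOp_zero]⟩
  · rintro ⟨h1, h2⟩ x hx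
    obtain ⟨a, ha, b, hb, rfl⟩ := (h.mem_iff x).mp hx
    exact (h2 a ha).mul_left (h1 b hb)

/-- Being logical ignores phases, so it says that each vector is orthogonal to the checks of the
opposite type and that the two vectors are not both sums of checks. -/
theorem isLogical_iff (h : IsFrameStabilizer f g V W S) (n : ℕ) (v w : Q → ZMod 2) :
    IsLogical S (phase Q ^ n * (frameOp f v * frameOp g w)) ↔
      ((∀ u ∈ W, v ⬝ᵥ u = 0) ∧ ∀ u ∈ V, w ⬝ᵥ u = 0) ∧ ¬ (v ∈ V ∧ w ∈ W) := by
  constructor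
  · intro hL
    refine ⟨(h.commute_iff n v w).mp hL.commute, fun hvw => hL.notMem (3 * n) ?_⟩
    rw [← mul_assoc, exists_phase_pow_mul_eq_one, one_mul]
    exact (h.mem_iff _).mpr ⟨v, hvw.1, w, hvw.2, rfl⟩
  · rintro ⟨hc, hn⟩
    refine ⟨?_, (h.commute_iff n v w).mpr hc, fun m hm => hn ?_⟩
    · exact mul_mem (phase_pow_mem_pauliGroup n)
        (mul_mem (frameOp_mem_pauliGroup f v) (frameOp_mem_pauliGroup g w))
    · rw [← mul_assoc, ← pow_add] at hm
      exact ((h.phase_mul_mem_iff _ _ _).mp hm).2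

theorem isStabilizerCode (h : IsFrameStabilizer f g V W S) {k : ℕ}
    (hk : Module.finrank (ZMod 2) V + Module.finrank (ZMod 2) W + k = Fintype.card Q) :
    IsStabilizerCode S k where
  le_pauliGroup := by
    intro x hx
    obtain ⟨v, hv, w, hw, rfl⟩ := (h.mem_iff x).mp hx
    exact mul_mem (frameOp_mem_pauliGroup f v) (frameOp_mem_pauliGroup g w)
  commute := by
    intro x hx y hy
    obtain ⟨v, hv, w, hw, rfl⟩ := (h.mem_iff y).mp hy
    have h1 := (h.commute_iff 0 v w).mpr ⟨h.orthogonal v hv, fun u hu => by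
      rw [dotProduct_comm]; exact h.orthogonal u hu w hw⟩ x hx
    simpa using h1
  neg_one_notMem := by
    intro hm
    rw [← phase_sq] at hm
    have h1 := (h.phase_mul_mem_iff 2 0 0).mp (by simpa [frameOp_zero] using hm)
    -- By uniqueness of the normal form, `-1 = i ^ 2` could lie in the group only if it were equal
    -- to `1`.
    have h2 : phase Q ^ (2 * (1 : ZMod 2).val) = 1 := by
      rw [ZMod.val_one]; exact h1.1
    exact one_ne_zero (phase_pow_two_mul_val_eq_one h2)
  exists_generators := by
    let bV := Module.finBasis (ZMod 2) V
    let bW := Module.finBasis (ZMod 2) W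
    let v : Fin (Module.finrank (ZMod 2) V) → Q → ZMod 2 := fun i => bV i
    let w : Fin (Module.finrank (ZMod 2) W) → Q → ZMod 2 := fun i => bW i
    have hv : LinearIndependent (ZMod 2) v :=
      bV.linearIndependent.map' V.subtype (Submodule.ker_subtype V)
    have hw : LinearIndependent (ZMod 2) w :=
      bW.linearIndependent.map' W.subtype (Submodule.ker_subtype W)
    have hsv : Submodule.span (ZMod 2) (Set.range v) = V := by
      have := congrArg (Submodule.map V.subtype) bV.span_eq
      rwa [Submodule.map_span, ← Set.range_comp, Submodule.map_top,
        Submodule.range_subtype] at this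
    have hsw : Submodule.span (ZMod 2) (Set.range w) = W := by
      have := congrArg (Submodule.map W.subtype) bW.span_eq
      rwa [Submodule.map_span, ← Set.range_comp, Submodule.map_top,
        Submodule.range_subtype] at this
    have horth : ∀ a ∈ Set.range v, ∀ b ∈ Set.range w, a ⬝ᵥ b = 0 := by
      rintro _ ⟨i, rfl⟩ _ ⟨j, rfl⟩
      exact h.orthogonal _ (bV i).2 _ (bW j).2
    let e := finSumFinEquiv (m := Module.finrank (ZMod 2) V) (n := Module.finrank (ZMod 2) W)
    refine ⟨_, hk, fun i => Sum.elim (fun i => frameOp f (v i)) (fun i => frameOp g (w i))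
      (e.symm i), ?_, ?_⟩
    · intro i hi
      obtain ⟨j, rfl⟩ := e.surjective i
      simp only [e.symm_apply_apply] at hi
      -- If a generator lay in the group generated by the others, uniqueness of the normal form
      -- would put its vector in the span of the remaining basis vectors of its type.
      rcases j with j | j
      · have hi' : frameOp f (v j) ∈ Subgroup.closure
            (frameOp f '' (v '' {j}ᶜ) ∪ frameOp g '' Set.range w) := by
          refine Subgroup.closure_mono ?_ hi
          rintro _ ⟨l, hl, rfl⟩
          obtain ⟨l, rfl⟩ := e.surjective l
          rcases l with l | l
          · exact Or.inl ⟨v l, ⟨l, fun e1 => hl (by rw [Set.mem_singleton_iff.mp e1]), rfl⟩,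
              by simp⟩
          · exact Or.inr ⟨w l, ⟨l, rfl⟩, by simp⟩
        obtain ⟨a, ha, b, hb, e1⟩ := (h.isFrame.mem_closure_iff (fun a ha b hb =>
          horth a (Set.image_subset_range _ _ ha) b hb) _).mp hi'
        have e2 := (h.isFrame.eq_of_phase_mul_eq (n := 0) (v := v j) (w := 0)
          (by simpa [frameOp_zero] using e1)).2.1
        exact hv.notMem_span_image (s := {j}ᶜ) (x := j) (by simp) (e2 ▸ ha)
      · have hi' : frameOp g (w j) ∈ Subgroup.closure
            (frameOp f '' Set.range v ∪ frameOp g '' (w '' {j}ᶜ)) := by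
          refine Subgroup.closure_mono ?_ hi
          rintro _ ⟨l, hl, rfl⟩
          obtain ⟨l, rfl⟩ := e.surjective l
          rcases l with l | l
          · exact Or.inl ⟨v l, ⟨l, rfl⟩, by simp⟩
          · exact Or.inr ⟨w l, ⟨l, fun e1 => hl (by rw [Set.mem_singleton_iff.mp e1]), rfl⟩,
              by simp⟩
        obtain ⟨a, ha, b, hb, e1⟩ := (h.isFrame.mem_closure_iff (fun a ha b hb =>
          horth a ha b (Set.image_subset_range _ _ hb)) _).mp hi'
        have e2 := (h.isFrame.eq_of_phase_mul_eq (n := 0) (v := 0) (w := w j)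
          (by simpa [frameOp_zero] using e1)).2.2
        exact hw.notMem_span_image (s := {j}ᶜ) (x := j) (by simp) (e2 ▸ hb)
    · have hr : Set.range (fun i => Sum.elim (fun i => frameOp f (v i))
          (fun i => frameOp g (w i)) (e.symm i)) =
          frameOp f '' Set.range v ∪ frameOp g '' Set.range w := by
        rw [← Set.range_comp, ← Set.range_comp, ← Set.Sum.elim_range]
        exact e.symm.surjective.range_comp _
      ext x
      rw [hr, h.isFrame.mem_closure_iff horth, hsv, hsw, h.mem_iff]

end IsFrameStabilizer

end Frames

/-! ### Tensor products of binary subspaces as spaces of matrices. -/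

section TensorSub

variable {ι κ : Type}

/-- A matrix lies in `U ⊗ V` iff its columns lie in `U` and its rows in `V`. This makes membership a
condition on products of matrices. -/
theorem mem_tensorSub_iff [Fintype ι] {U : Submodule (ZMod 2) (ι → ZMod 2)}
    {V : Submodule (ZMod 2) (κ → ZMod 2)} {r : ι × κ → ZMod 2} :
    r ∈ tensorSub U V ↔ (∀ j, (fun i => r (i, j)) ∈ U) ∧ ∀ i, (fun j => r (i, j)) ∈ V := by
  classical
  constructor
  · intro hr
    induction hr using Submodule.span_induction with
    | zero => exact ⟨fun _ => zero_mem U, fun _ => zero_mem V⟩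
    | add r s _ _ hr hs =>
      exact ⟨fun j => add_mem (hr.1 j) (hs.1 j), fun i => add_mem (hr.2 i) (hs.2 i)⟩
    | smul c r _ hr => exact ⟨fun j => U.smul_mem c (hr.1 j), fun i => V.smul_mem c (hr.2 i)⟩
    | mem r hr =>
      obtain ⟨x, hx, y, hy, rfl⟩ := hr
      refine ⟨fun j => ?_, fun i => V.smul_mem (x i) hy⟩
      convert U.smul_mem (y j) hx using 1
      funext i
      exact mul_comm _ _
  · rintro ⟨h1, h2⟩
    -- A projection `p` onto `U` fixes every column of `r`; expanding the columns in unit vectors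
    -- writes `r` as the sum of `p(e_k) ⊗ (row k)`.
    obtain ⟨p, hp⟩ := U.subtype.exists_leftInverse_of_injective (Submodule.ker_subtype U)
    have hp' : ∀ u (hu : u ∈ U), (p u : ι → ZMod 2) = u := fun u hu =>
      congrArg Subtype.val (LinearMap.congr_fun hp ⟨u, hu⟩)
    have e : r = ∑ k, fun q : ι × κ => (p (Pi.single k 1) : ι → ZMod 2) q.1 * r (k, q.2) := by
      funext q
      obtain ⟨i, j⟩ := q
      rw [Finset.sum_apply]
      have h3 := hp' _ (h1 j)
      have h4 : (fun i => r (i, j)) = ∑ k, r (k, j) • (Pi.single k 1 : ι → ZMod 2) := by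
        funext i
        simp [Finset.sum_apply, Pi.single_apply]
      rw [h4, map_sum] at h3
      have h5 := congrFun h3 i
      rw [← h4] at h5
      simp only [map_smul, Submodule.coe_sum, Submodule.coe_smul, Finset.sum_apply,
        Pi.smul_apply, smul_eq_mul] at h5
      rw [← h5]
      exact Finset.sum_congr rfl fun k _ => mul_comm _ _
    rw [e]
    refine Submodule.sum_mem _ fun k _ => Submodule.subset_span ?_
    exact ⟨_, (p (Pi.single k 1)).2, fun j => r (k, j), h2 k, rfl⟩

/-- The space is the image of the abstract tensor product, which embeds by flatness. -/
theorem finrank_tensorSub [Fintype ι] [Fintype κ] (U : Submodule (ZMod 2) (ι → ZMod 2))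
    (V : Submodule (ZMod 2) (κ → ZMod 2)) :
    Module.finrank (ZMod 2) (tensorSub U V) =
      Module.finrank (ZMod 2) U * Module.finrank (ZMod 2) V := by
  classical
  let b := (Pi.basisFun (ZMod 2) ι).tensorProduct (Pi.basisFun (ZMod 2) κ)
  let F : TensorProduct (ZMod 2) U V →ₗ[ZMod 2] (ι × κ → ZMod 2) :=
    b.equivFun.toLinearMap ∘ₗ TensorProduct.map U.subtype V.subtype
  have hF : Function.Injective F :=
    b.equivFun.injective.comp (Module.Flat.tensorProduct_mapIncl_injective_of_right U V)
  have hr : LinearMap.range F = tensorSub U V := by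
    rw [LinearMap.range_eq_map, ← TensorProduct.span_tmul_eq_top, Submodule.map_span, tensorSub]
    congr 1
    ext r
    constructor
    · rintro ⟨_, ⟨x, y, rfl⟩, rfl⟩
      refine ⟨x, x.2, y, y.2, ?_⟩
      funext ⟨i, j⟩
      simp [F, b, Module.Basis.tensorProduct_repr_tmul_apply, mul_comm]
    · rintro ⟨x, hx, y, hy, rfl⟩
      refine ⟨_, ⟨⟨x, hx⟩, ⟨y, hy⟩, rfl⟩, ?_⟩
      funext ⟨i, j⟩
      simp [F, b, Module.Basis.tensorProduct_repr_tmul_apply, mul_comm]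
  rw [← hr, LinearMap.finrank_range_of_inj hF, Module.finrank_tensorProduct]

end TensorSub

/-! ### Complements of images: dual families and projections. -/

section Complements

variable {ι : Type} [Fintype ι] {W U : Submodule (ZMod 2) (ι → ZMod 2)}

/-- The vectors represent, for the dot product, the coordinate functionals of `b` composed with the
projection onto `W` along `U`. -/
theorem exists_dual_family {J : Type} [DecidableEq J] (h : IsCompl W U)
    (b : Module.Basis J (ZMod 2) W) :
    ∃ e : J → ι → ZMod 2, (∀ j, ∀ u ∈ U, e j ⬝ᵥ u = 0) ∧
      ∀ i j, e i ⬝ᵥ (b j : ι → ZMod 2) = if i = j then 1 else 0 := by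
  classical
  let φ : J → (ι → ZMod 2) →ₗ[ZMod 2] ZMod 2 := fun j =>
    b.coord j ∘ₗ Submodule.projectionOnto W U h
  have hφ : ∀ j v, (fun k => φ j (Pi.single k 1)) ⬝ᵥ v = φ j v := by
    intro j v
    refine Eq.trans ?_ (congrArg (φ j) (pi_eq_sum_univ' v)).symm
    rw [map_sum]
    simp [dotProduct, mul_comm]
  refine ⟨fun j k => φ j (Pi.single k 1), fun j u hu => ?_, fun i j => ?_⟩
  · rw [hφ]
    simp [φ, Submodule.projectionOnto_apply_of_mem_right h hu]
  · rw [hφ]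
    simp [φ, Finsupp.single_apply, eq_comm]

theorem finrank_ker_transpose_of_isCompl {κ : Type} [Fintype κ] (H : Matrix ι κ (ZMod 2))
    (h : IsCompl W (LinearMap.range H.mulVecLin)) :
    Module.finrank (ZMod 2) W = Module.finrank (ZMod 2) (LinearMap.ker H.transpose.mulVecLin) := by
  have h1 := Submodule.finrank_add_eq_of_isCompl h
  have h2 := LinearMap.finrank_range_add_finrank_ker H.transpose.mulVecLin
  have h3 : Module.finrank (ZMod 2) (LinearMap.range H.transpose.mulVecLin) =
    Module.finrank (ZMod 2) (LinearMap.range H.mulVecLin) := Matrix.rank_transpose H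
  omega

/-- `R` projects onto the image of `H` along `W` and then chooses a preimage linearly. Having `R` as
a matrix lets it act on all rows or columns of a matrix at once. -/
theorem exists_sub_mulVec_mem {κ : Type} [Fintype κ] (H : Matrix ι κ (ZMod 2))
    (h : IsCompl W (LinearMap.range H.mulVecLin)) :
    ∃ R : Matrix κ ι (ZMod 2), ∀ v, v - H.mulVec (R.mulVec v) ∈ W := by
  obtain ⟨s, hs⟩ := H.mulVecLin.rangeRestrict.exists_rightInverse_of_surjective
    (LinearMap.range_rangeRestrict _)
  classical
  refine ⟨LinearMap.toMatrix' (s ∘ₗ Submodule.projectionOnto _ W h.symm), fun v => ?_⟩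
  rw [LinearMap.toMatrix'_mulVec]
  have h1 : H.mulVec (s (Submodule.projectionOnto _ W h.symm v)) =
      Submodule.projectionOnto _ W h.symm v :=
    congrArg Subtype.val (LinearMap.congr_fun hs (Submodule.projectionOnto _ W h.symm v))
  rw [LinearMap.comp_apply, h1]
  have h2 := Submodule.projection_add_projection_eq_self h v
  rw [Submodule.coe_projectionOnto_apply, sub_eq_of_eq_add h2.symm]
  exact Submodule.projection_apply_mem h v

end Complements

/-! ### Split complements and bases adapted to two blocks. -/

section Blocks

variable {α β : Type}

/-- Filter `U` by the projection to `α`. A complement `A` of the image and a complement `B` of the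
`β`-parts of the vectors of `U` vanishing on `α` combine to a complement of `U`: `u ∈ U` corrects
the `α`-part, then `u' ∈ U` corrects the `β`-part without touching it. -/
theorem exists_isCompl_isBlockAdapted (U : Submodule (ZMod 2) (α ⊕ β → ZMod 2)) :
    ∃ W, IsCompl W U ∧ IsBlockAdapted W := by
  let pα : (α ⊕ β → ZMod 2) →ₗ[ZMod 2] (α → ZMod 2) := LinearMap.funLeft _ _ Sum.inl
  let pβ : (α ⊕ β → ZMod 2) →ₗ[ZMod 2] (β → ZMod 2) := LinearMap.funLeft _ _ Sum.inr
  obtain ⟨A, hA⟩ := Submodule.exists_isCompl (U.map pα)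
  obtain ⟨B, hB⟩ := Submodule.exists_isCompl ((U ⊓ LinearMap.ker pα).map pβ)
  have hmem : ∀ y, y ∈ A.comap pα ⊓ B.comap pβ ↔ pα y ∈ A ∧ pβ y ∈ B := fun y => Iff.rfl
  refine ⟨A.comap pα ⊓ B.comap pβ, ⟨?_, ?_⟩, ?_⟩
  · rw [Submodule.disjoint_def]
    intro y hy hU
    rw [hmem] at hy
    have h1 : pα y = 0 := Submodule.disjoint_def.mp hA.disjoint _ ⟨y, hU, rfl⟩ hy.1
    have h2 : pβ y = 0 := Submodule.disjoint_def.mp hB.disjoint _ ⟨y, ⟨hU, h1⟩, rfl⟩ hy.2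
    funext i
    rcases i with i | i
    · exact congrFun h1 i
    · exact congrFun h2 i
  · rw [codisjoint_iff_le_sup]
    intro y _
    obtain ⟨_, ⟨u, hu, rfl⟩, a, ha, e1⟩ := Submodule.mem_sup.mp
      (hA.sup_eq_top ▸ Submodule.mem_top : pα y ∈ U.map pα ⊔ A)
    obtain ⟨_, ⟨u', hu', rfl⟩, b, hb, e2⟩ := Submodule.mem_sup.mp
      (hB.sup_eq_top ▸ Submodule.mem_top : pβ (y - u) ∈ (U ⊓ LinearMap.ker pα).map pβ ⊔ B)
    refine Submodule.mem_sup.mpr ⟨Sum.elim a b, ⟨ha, hb⟩, u + u', add_mem hu hu'.1, ?_⟩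
    have hu2 : pα u' = 0 := hu'.2
    funext i
    rcases i with i | i
    · have h1 := congrFun e1 i
      have h2 := congrFun hu2 i
      simp only [pα, LinearMap.funLeft_apply, Pi.add_apply, Pi.zero_apply] at h1 h2
      simp [h2, ← h1, add_comm]
    · have h1 := congrFun e2 i
      simp only [pβ, LinearMap.funLeft_apply, Pi.add_apply, Pi.sub_apply] at h1
      simp only [Pi.add_apply, Sum.elim_inr]
      linear_combination h1
  · intro y hy
    exact ⟨hy.1, zero_mem B⟩

/-- In a split space the vectors supported on one block span, so a basis can be extracted from them.
The condition stands inside the existential so that the same basis serves whether or not `W` is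
split. -/
theorem exists_basis_of_isBlockAdapted [Fintype α] [Fintype β]
    (W : Submodule (ZMod 2) (α ⊕ β → ZMod 2)) :
    ∃ b : Module.Basis (Fin (Module.finrank (ZMod 2) W)) (ZMod 2) W, IsBlockAdapted W →
      ∀ i, (∀ a, (b i : α ⊕ β → ZMod 2) (Sum.inl a) = 0) ∨
        ∀ a, (b i : α ⊕ β → ZMod 2) (Sum.inr a) = 0 := by
  by_cases h : IsBlockAdapted W
  swap
  · exact ⟨Module.finBasis _ _, fun h' => absurd h' h⟩
  let s : Set W := {w | (∀ a, (w : α ⊕ β → ZMod 2) (Sum.inl a) = 0) ∨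
    ∀ a, (w : α ⊕ β → ZMod 2) (Sum.inr a) = 0}
  have hs : ⊤ ≤ Submodule.span (ZMod 2) s := by
    intro w _
    let u : W := ⟨_, h w.1 w.2⟩
    have hu : u ∈ s := Or.inr fun a => rfl
    have hv : w - u ∈ s := Or.inl fun a => by simp [u]
    have h1 := Submodule.add_mem _ (Submodule.subset_span (R := ZMod 2) hu)
      (Submodule.subset_span hv)
    simpa using h1
  let b := Module.Basis.ofSpan hs
  have := FiniteDimensional.fintypeBasisIndex b
  let e := Fintype.equivFinOfCardEq (Module.finrank_eq_card_basis b).symm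
  refine ⟨b.reindex e, fun _ i => ?_⟩
  rw [Module.Basis.reindex_apply]
  exact Module.Basis.ofSpan_subset hs ⟨_, rfl⟩

end Blocks

/-! ### Hypergraph products: cycles modulo boundaries, orthogonality, and ranks. -/

section HypergraphProduct

set_option linter.unusedSectionVars false

variable {M N A B : Type} [Fintype M] [Fintype N] [Fintype A] [Fintype B]

theorem mulVec_mem_range (H : Matrix M B (ZMod 2)) (v : B → ZMod 2) :
    H.mulVec v ∈ LinearMap.range H.mulVecLin := ⟨v, rfl⟩

theorem mul_transpose_row (X : Matrix A B (ZMod 2)) (H : Matrix N B (ZMod 2)) (i : A) :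
    (X * H.transpose) i = H.mulVec (X i) := by
  funext j
  simp [Matrix.mul_apply, Matrix.mulVec, dotProduct, mul_comm]

theorem mul_row_mem {W : Submodule (ZMod 2) (N → ZMod 2)} (L : Matrix A M (ZMod 2))
    (X : Matrix M N (ZMod 2)) (hX : ∀ i, X i ∈ W) (i : A) : (L * X) i ∈ W := by
  have e : (L * X) i = ∑ k, L i k • X k := by
    funext j
    simp [Matrix.mul_apply, Finset.sum_apply]
  rw [e]
  exact Submodule.sum_mem _ fun k _ => W.smul_mem _ (hX k)

theorem uncurry_mem_tensorSub_ker_left {H : Matrix M A (ZMod 2)}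
    {W : Submodule (ZMod 2) (B → ZMod 2)}
    {X : Matrix A B (ZMod 2)} :
    Function.uncurry X ∈ tensorSub (LinearMap.ker H.mulVecLin) W ↔ H * X = 0 ∧ ∀ i, X i ∈ W := by
  rw [mem_tensorSub_iff]
  refine and_congr ⟨fun h => ?_, fun h j => ?_⟩ Iff.rfl
  · ext i j
    exact congrFun (h j) i
  · funext i
    exact congrFun (congrFun h i) j

theorem uncurry_mem_tensorSub_ker_right {H : Matrix N B (ZMod 2)}
    {W : Submodule (ZMod 2) (A → ZMod 2)} {X : Matrix A B (ZMod 2)} :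
    Function.uncurry X ∈ tensorSub W (LinearMap.ker H.mulVecLin) ↔
      (∀ j, (fun i => X i j) ∈ W) ∧ X * H.transpose = 0 := by
  rw [mem_tensorSub_iff]
  refine and_congr Iff.rfl ⟨fun h => ?_, fun h i => ?_⟩
  · ext i j
    rw [mul_transpose_row]
    exact congrFun (h i) j
  · change H.mulVec (X i) = 0
    rw [← mul_transpose_row, h]
    rfl

/-- A cycle of the product complex is a boundary plus a tensor product of a cycle and a vector of a
complement of the boundaries in each of the two parts. -/
theorem exists_boundary_add_of_cycle (H : Matrix M A (ZMod 2)) (G : Matrix N B (ZMod 2))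
    {WA : Submodule (ZMod 2) (A → ZMod 2)} {WN : Submodule (ZMod 2) (N → ZMod 2)}
    (hWA : IsCompl WA (LinearMap.range H.transpose.mulVecLin))
    (hWN : IsCompl WN (LinearMap.range G.mulVecLin))
    {X : Matrix M N (ZMod 2)} {Y : Matrix A B (ZMod 2)}
    (hXY : H.transpose * X + Y * G.transpose = 0) :
    ∃ (U : Matrix M B (ZMod 2)) (X' : Matrix M N (ZMod 2)) (Y' : Matrix A B (ZMod 2)),
      X = U * G.transpose + X' ∧ Y = H.transpose * U + Y' ∧
      Function.uncurry X' ∈ tensorSub (LinearMap.ker H.transpose.mulVecLin) WN ∧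
      Function.uncurry Y' ∈ tensorSub WA (LinearMap.ker G.mulVecLin) := by
  obtain ⟨R, hR⟩ := exists_sub_mulVec_mem G hWN
  obtain ⟨L, hL⟩ := exists_sub_mulVec_mem H.transpose hWA
  -- Row by row, subtracting `U * G.transpose` leaves the `WN`-component of `X`.
  set U := X * R.transpose with hU
  set X₁ := X - U * G.transpose with hX₁
  set Y₁ := Y - H.transpose * U with hY₁
  have hX₁W : ∀ i, X₁ i ∈ WN := by
    intro i
    have : X₁ i = X i - G.mulVec (R.mulVec (X i)) := by
      rw [← mul_transpose_row X R, ← mul_transpose_row]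
      rfl
    rw [this]
    exact hR _
  have e : H.transpose * X₁ = Y₁ * G.transpose := by
    rw [hX₁, hY₁, Matrix.mul_sub, Matrix.sub_mul, Matrix.mul_assoc H.transpose U,
      sub_left_inj]
    ext i j
    exact CharTwo.add_eq_zero.mp (congrFun (congrFun hXY i) j)
  -- Rows of `Hᵀ X₁` are combinations of rows of `X₁`, so they lie in `WN`; being rows of `Y₁ Gᵀ`,
  -- they also lie in the image of `G`. The two spaces meet in zero.
  have e0 : H.transpose * X₁ = 0 := by
    ext i j
    refine congrFun (Submodule.disjoint_def.mp hWN.disjoint _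
      (mul_row_mem H.transpose X₁ hX₁W i) ?_) j
    rw [e, mul_transpose_row]
    exact mulVec_mem_range _ _
  rw [e0] at e
  -- The second correction `L * Y₁` moves the columns of `Y₁` into `WA`. It leaves `X₁` unchanged
  -- because `Y₁ Gᵀ = 0`.
  refine ⟨U + L * Y₁, X₁, Y₁ - H.transpose * (L * Y₁), ?_, ?_, ?_, ?_⟩
  · rw [Matrix.add_mul, Matrix.mul_assoc L, ← e, Matrix.mul_zero, hX₁]
    abel
  · rw [Matrix.mul_add, hY₁]
    abel
  · exact uncurry_mem_tensorSub_ker_left.mpr ⟨e0, hX₁W⟩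
  · refine uncurry_mem_tensorSub_ker_right.mpr ⟨fun j => hL fun i => Y₁ i j, ?_⟩
    rw [Matrix.sub_mul, Matrix.mul_assoc, Matrix.mul_assoc L, ← e, Matrix.mul_zero,
      Matrix.mul_zero, sub_zero]

/-- Rows of `U Gᵀ` lie in the image of `G` and in its complement; columns of `Hᵀ U` lie in the image
of `Hᵀ` and in its complement. -/
theorem eq_zero_of_boundary_mem (H : Matrix M A (ZMod 2)) (G : Matrix N B (ZMod 2))
    {WA : Submodule (ZMod 2) (A → ZMod 2)} {WN : Submodule (ZMod 2) (N → ZMod 2)}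
    (hWA : IsCompl WA (LinearMap.range H.transpose.mulVecLin))
    (hWN : IsCompl WN (LinearMap.range G.mulVecLin)) (U : Matrix M B (ZMod 2))
    (hX : Function.uncurry (U * G.transpose) ∈
      tensorSub (LinearMap.ker H.transpose.mulVecLin) WN)
    (hY : Function.uncurry (H.transpose * U) ∈ tensorSub WA (LinearMap.ker G.mulVecLin)) :
    U * G.transpose = 0 ∧ H.transpose * U = 0 := by
  rw [uncurry_mem_tensorSub_ker_left] at hX
  rw [uncurry_mem_tensorSub_ker_right] at hY
  constructor
  · ext i j
    refine congrFun (Submodule.disjoint_def.mp hWN.disjoint _ (hX.2 i) ?_) j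
    rw [mul_transpose_row]
    exact mulVec_mem_range _ _
  · ext i j
    refine congrFun (Submodule.disjoint_def.mp hWA.disjoint _ (hY.1 j) ?_) i
    exact mulVec_mem_range _ _

/-- The checks `(U Gᵀ, Hᵀ U)` of the hypergraph product of `H` and `G`. -/
def hgpLeft (H : Matrix M A (ZMod 2)) (G : Matrix N B (ZMod 2)) :
    Matrix M B (ZMod 2) →ₗ[ZMod 2] ((M × N) ⊕ (A × B) → ZMod 2) where
  toFun U := Sum.elim (Function.uncurry (U * G.transpose)) (Function.uncurry (H.transpose * U))
  map_add' U V := by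
    rw [Matrix.add_mul, Matrix.mul_add]
    funext i; rcases i with i | i <;> rfl
  map_smul' c U := by
    rw [Matrix.smul_mul, Matrix.mul_smul]
    funext i; rcases i with i | i <;> rfl

/-- The checks `(H T, T G)` of the hypergraph product of `H` and `G`. -/
def hgpRight (H : Matrix M A (ZMod 2)) (G : Matrix N B (ZMod 2)) :
    Matrix A N (ZMod 2) →ₗ[ZMod 2] ((M × N) ⊕ (A × B) → ZMod 2) where
  toFun T := Sum.elim (Function.uncurry (H * T)) (Function.uncurry (T * G))
  map_add' U V := by
    rw [Matrix.add_mul, Matrix.mul_add]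
    funext i; rcases i with i | i <;> rfl
  map_smul' c U := by
    rw [Matrix.smul_mul, Matrix.mul_smul]
    funext i; rcases i with i | i <;> rfl

theorem uncurry_dotProduct_uncurry (X Y : Matrix M N (ZMod 2)) :
    Function.uncurry X ⬝ᵥ Function.uncurry Y = (X.transpose * Y).trace := by
  simp only [dotProduct, Matrix.trace, Matrix.mul_apply, Matrix.diag, Matrix.transpose_apply,
    Fintype.sum_prod_type, Function.uncurry]
  exact Finset.sum_comm

/-- The adjoint of the right check map is the boundary `Hᵀ X + Y Gᵀ`. With the nondegenerate trace
form, orthogonality to all right checks becomes the cycle condition. -/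
theorem sumElim_dotProduct_hgpRight (H : Matrix M A (ZMod 2)) (G : Matrix N B (ZMod 2))
    (X : Matrix M N (ZMod 2)) (Y : Matrix A B (ZMod 2)) (T : Matrix A N (ZMod 2)) :
    Sum.elim (Function.uncurry X) (Function.uncurry Y) ⬝ᵥ hgpRight H G T =
      ((H.transpose * X + Y * G.transpose).transpose * T).trace := by
  rw [hgpRight, LinearMap.coe_mk, AddHom.coe_mk, sumElim_dotProduct_sumElim,
    uncurry_dotProduct_uncurry, uncurry_dotProduct_uncurry, Matrix.transpose_add, Matrix.add_mul,
    Matrix.trace_add, Matrix.transpose_mul, Matrix.transpose_mul, Matrix.transpose_transpose,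
    Matrix.transpose_transpose, ← Matrix.mul_assoc, Matrix.trace_mul_cycle' Y.transpose T G,
    Matrix.mul_assoc G]

theorem sumElim_dotProduct_hgpLeft (H : Matrix M A (ZMod 2)) (G : Matrix N B (ZMod 2))
    (X : Matrix M N (ZMod 2)) (Y : Matrix A B (ZMod 2)) (U : Matrix M B (ZMod 2)) :
    Sum.elim (Function.uncurry X) (Function.uncurry Y) ⬝ᵥ hgpLeft H G U =
      ((X * G + H * Y).transpose * U).trace := by
  rw [hgpLeft, LinearMap.coe_mk, AddHom.coe_mk, sumElim_dotProduct_sumElim,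
    uncurry_dotProduct_uncurry, uncurry_dotProduct_uncurry, Matrix.transpose_add, Matrix.add_mul,
    Matrix.trace_add, Matrix.transpose_mul, Matrix.transpose_mul,
    Matrix.trace_mul_cycle' X.transpose U, Matrix.mul_assoc G.transpose,
    Matrix.mul_assoc Y.transpose]

/-- The boundary of a left check is `Hᵀ U Gᵀ` taken twice, which vanishes in characteristic 2. -/
theorem hgpLeft_dotProduct_hgpRight (H : Matrix M A (ZMod 2)) (G : Matrix N B (ZMod 2))
    (U : Matrix M B (ZMod 2)) (T : Matrix A N (ZMod 2)) :
    hgpLeft H G U ⬝ᵥ hgpRight H G T = 0 := by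
  rw [hgpLeft, LinearMap.coe_mk, AddHom.coe_mk, sumElim_dotProduct_hgpRight, Matrix.mul_assoc]
  have h : H.transpose * (U * G.transpose) + H.transpose * (U * G.transpose) = 0 := by
    ext i j
    exact CharTwo.add_self_eq_zero _
  rw [h, Matrix.transpose_zero, Matrix.zero_mul, Matrix.trace_zero]

theorem eq_zero_of_trace_mul_eq_zero {Z : Matrix M N (ZMod 2)}
    (h : ∀ T : Matrix M N (ZMod 2), (Z.transpose * T).trace = 0) : Z = 0 := by
  have := Matrix.ext_iff_trace_mul_right (A := Z.transpose) (B := 0)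
  rw [← Matrix.transpose_eq_zero, this]
  intro T
  rw [h, Matrix.zero_mul, Matrix.trace_zero]

theorem orthogonal_hgpRight_iff (H : Matrix M A (ZMod 2)) (G : Matrix N B (ZMod 2))
    {WA : Submodule (ZMod 2) (A → ZMod 2)} {WN : Submodule (ZMod 2) (N → ZMod 2)}
    (hWA : IsCompl WA (LinearMap.range H.transpose.mulVecLin))
    (hWN : IsCompl WN (LinearMap.range G.mulVecLin)) (z : (M × N) ⊕ (A × B) → ZMod 2) :
    (∀ T, z ⬝ᵥ hgpRight H G T = 0) ↔
      ∃ U, ∃ x ∈ tensorSub (LinearMap.ker H.transpose.mulVecLin) WN,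
        ∃ y ∈ tensorSub WA (LinearMap.ker G.mulVecLin), z = hgpLeft H G U + Sum.elim x y := by
  constructor
  · intro h
    obtain ⟨X, Y, rfl⟩ : ∃ (X : Matrix M N (ZMod 2)) (Y : Matrix A B (ZMod 2)),
        z = Sum.elim (Function.uncurry X) (Function.uncurry Y) :=
      ⟨fun i j => z (.inl (i, j)), fun i j => z (.inr (i, j)),
        funext fun i => by rcases i with i | i <;> rfl⟩
    simp only [sumElim_dotProduct_hgpRight] at h
    obtain ⟨U, X', Y', rfl, rfl, hX, hY⟩ :=
      exists_boundary_add_of_cycle H G hWA hWN (eq_zero_of_trace_mul_eq_zero h)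
    exact ⟨U, _, hX, _, hY, funext fun i => by rcases i with i | i <;> rfl⟩
  · rintro ⟨U, x, hx, y, hy, rfl⟩ T
    rw [add_dotProduct, hgpLeft_dotProduct_hgpRight, zero_add]
    obtain ⟨X, rfl⟩ : ∃ X : Matrix M N (ZMod 2), x = Function.uncurry X :=
      ⟨fun i j => x (i, j), rfl⟩
    obtain ⟨Y, rfl⟩ : ∃ Y : Matrix A B (ZMod 2), y = Function.uncurry Y :=
      ⟨fun i j => y (i, j), rfl⟩
    have h1 := (uncurry_mem_tensorSub_ker_left.mp hx).1
    have h2 := (uncurry_mem_tensorSub_ker_right.mp hy).2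
    rw [sumElim_dotProduct_hgpRight, h1, h2]
    simp

theorem eq_zero_of_mem_range_hgpLeft (H : Matrix M A (ZMod 2)) (G : Matrix N B (ZMod 2))
    {WA : Submodule (ZMod 2) (A → ZMod 2)} {WN : Submodule (ZMod 2) (N → ZMod 2)}
    (hWA : IsCompl WA (LinearMap.range H.transpose.mulVecLin))
    (hWN : IsCompl WN (LinearMap.range G.mulVecLin)) {x : M × N → ZMod 2} {y : A × B → ZMod 2}
    (hx : x ∈ tensorSub (LinearMap.ker H.transpose.mulVecLin) WN)
    (hy : y ∈ tensorSub WA (LinearMap.ker G.mulVecLin))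
    (h : Sum.elim x y ∈ LinearMap.range (hgpLeft H G)) :
    x = 0 ∧ y = 0 := by
  obtain ⟨U, hU⟩ := h
  obtain rfl : Function.uncurry (U * G.transpose) = x := funext fun i => congrFun hU (.inl i)
  obtain rfl : Function.uncurry (H.transpose * U) = y := funext fun i => congrFun hU (.inr i)
  obtain ⟨h1, h2⟩ := eq_zero_of_boundary_mem H G hWA hWN U hx hy
  rw [h1, h2]
  exact ⟨rfl, rfl⟩

theorem tensorSub_swap {ι κ : Type} [Fintype ι] [Fintype κ] {U : Submodule (ZMod 2) (ι → ZMod 2)}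
    {V : Submodule (ZMod 2) (κ → ZMod 2)} {r : ι × κ → ZMod 2} :
    r ∘ Prod.swap ∈ tensorSub V U ↔ r ∈ tensorSub U V := by
  rw [mem_tensorSub_iff, mem_tensorSub_iff]
  exact and_comm

/-- Exchanging the two factors of a hypergraph product. -/
def hgpSwap : (M × N) ⊕ (A × B) ≃ (N × M) ⊕ (B × A) :=
  Equiv.sumCongr (Equiv.prodComm M N) (Equiv.prodComm A B)

/-- Transposing matrices and exchanging `H` with `G` turns right checks into left checks, so each
statement about one side gives the other. -/
theorem hgpRight_comp_swap (H : Matrix M A (ZMod 2)) (G : Matrix N B (ZMod 2))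
    (T : Matrix A N (ZMod 2)) : hgpLeft G H T.transpose ∘ hgpSwap = hgpRight H G T := by
  funext i
  rcases i with ⟨i, j⟩ | ⟨i, j⟩
  · exact congrFun (congrFun (Matrix.transpose_mul T.transpose H.transpose) i) j
  · exact congrFun (congrFun (Matrix.transpose_mul G.transpose T.transpose) i) j

theorem hgpLeft_comp_swap (H : Matrix M A (ZMod 2)) (G : Matrix N B (ZMod 2))
    (U : Matrix M B (ZMod 2)) : hgpRight G H U.transpose ∘ hgpSwap = hgpLeft H G U := by
  funext i
  rcases i with ⟨i, j⟩ | ⟨i, j⟩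
  · exact congrFun (congrFun (Matrix.transpose_mul G U.transpose) i) j
  · exact congrFun (congrFun (Matrix.transpose_mul U.transpose H) i) j

theorem orthogonal_hgpLeft_iff (H : Matrix M A (ZMod 2)) (G : Matrix N B (ZMod 2))
    {WM : Submodule (ZMod 2) (M → ZMod 2)} {WB : Submodule (ZMod 2) (B → ZMod 2)}
    (hWM : IsCompl WM (LinearMap.range H.mulVecLin))
    (hWB : IsCompl WB (LinearMap.range G.transpose.mulVecLin)) (z : (M × N) ⊕ (A × B) → ZMod 2) :
    (∀ U, z ⬝ᵥ hgpLeft H G U = 0) ↔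
      ∃ T, ∃ x ∈ tensorSub WM (LinearMap.ker G.transpose.mulVecLin),
        ∃ y ∈ tensorSub (LinearMap.ker H.mulVecLin) WB, z = hgpRight H G T + Sum.elim x y := by
  have h1 := orthogonal_hgpRight_iff G H hWB hWM (z ∘ hgpSwap.symm)
  have h2 : (∀ U, z ⬝ᵥ hgpLeft H G U = 0) ↔ ∀ T, (z ∘ hgpSwap.symm) ⬝ᵥ hgpRight G H T = 0 := by
    have key : ∀ U, z ⬝ᵥ hgpLeft H G U = (z ∘ hgpSwap.symm) ⬝ᵥ hgpRight G H U.transpose := by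
      intro U
      rw [← hgpLeft_comp_swap, ← comp_equiv_symm_dotProduct]
    exact ⟨fun h T => by rw [← T.transpose_transpose, ← key]; exact h _, fun h U => by
      rw [key]; exact h _⟩
  rw [h2, h1]
  constructor
  · rintro ⟨U, x, hx, y, hy, e⟩
    refine ⟨U.transpose, x ∘ Prod.swap, tensorSub_swap.mpr hx, y ∘ Prod.swap,
      tensorSub_swap.mpr hy, ?_⟩
    rw [← hgpRight_comp_swap, Matrix.transpose_transpose]
    funext i
    have e1 := congrFun e (hgpSwap i)
    rw [Function.comp_apply, Equiv.symm_apply_apply] at e1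
    rw [e1]
    rcases i with i | i <;> rfl
  · rintro ⟨T, x, hx, y, hy, rfl⟩
    refine ⟨T.transpose, x ∘ Prod.swap, tensorSub_swap.mpr hx, y ∘ Prod.swap,
      tensorSub_swap.mpr hy, ?_⟩
    rw [← hgpRight_comp_swap]
    funext i
    rcases i with i | i <;> rfl

theorem eq_zero_of_mem_range_hgpRight (H : Matrix M A (ZMod 2)) (G : Matrix N B (ZMod 2))
    {WM : Submodule (ZMod 2) (M → ZMod 2)} {WB : Submodule (ZMod 2) (B → ZMod 2)}
    (hWM : IsCompl WM (LinearMap.range H.mulVecLin))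
    (hWB : IsCompl WB (LinearMap.range G.transpose.mulVecLin))
    {x : M × N → ZMod 2} {y : A × B → ZMod 2}
    (hx : x ∈ tensorSub WM (LinearMap.ker G.transpose.mulVecLin))
    (hy : y ∈ tensorSub (LinearMap.ker H.mulVecLin) WB)
    (h : Sum.elim x y ∈ LinearMap.range (hgpRight H G)) : x = 0 ∧ y = 0 := by
  obtain ⟨T, hT⟩ := h
  obtain ⟨h1, h2⟩ := eq_zero_of_mem_range_hgpLeft G H hWB hWM (x := x ∘ Prod.swap)
    (y := y ∘ Prod.swap) (tensorSub_swap.mpr hx) (tensorSub_swap.mpr hy) ⟨T.transpose, by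
      rw [← hgpRight_comp_swap, ← Equiv.eq_comp_symm] at hT
      rw [hT]
      funext i
      rcases i with i | i <;> rfl⟩
  exact ⟨funext fun p => congrFun h1 p.swap, funext fun p => congrFun h2 p.swap⟩

/-- Rank-nullity: `U` is in the kernel iff `Hᵀ U = 0` and `U Gᵀ = 0`, that is, iff it lies in `ker
Hᵀ ⊗ ker G`. -/
theorem finrank_range_hgpLeft (H : Matrix M A (ZMod 2)) (G : Matrix N B (ZMod 2)) :
    Module.finrank (ZMod 2) (LinearMap.range (hgpLeft H G)) +
      Module.finrank (ZMod 2) (LinearMap.ker H.transpose.mulVecLin) *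
        Module.finrank (ZMod 2) (LinearMap.ker G.mulVecLin) =
      Fintype.card M * Fintype.card B := by
  have h1 := LinearMap.finrank_range_add_finrank_ker (hgpLeft H G)
  rw [Module.finrank_matrix, Module.finrank_self, mul_one] at h1
  rw [← h1, ← finrank_tensorSub]
  congr 1
  let e : Matrix M B (ZMod 2) ≃ₗ[ZMod 2] (M × B → ZMod 2) :=
    (LinearEquiv.curry (ZMod 2) (ZMod 2) M B).symm
  have h2 : (LinearMap.ker (hgpLeft H G)).map e.toLinearMap =
      tensorSub (LinearMap.ker H.transpose.mulVecLin) (LinearMap.ker G.mulVecLin) := by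
    ext x
    obtain ⟨U, rfl⟩ := e.surjective x
    change e U ∈ _ ↔ Function.uncurry U ∈ _
    rw [Submodule.mem_map_equiv, e.symm_apply_apply, uncurry_mem_tensorSub_ker_left,
      LinearMap.mem_ker]
    constructor
    · intro h
      refine ⟨?_, fun i => ?_⟩
      · ext i j
        exact congrFun h (.inr (i, j))
      · funext j
        change G.mulVec (U i) j = 0
        rw [← mul_transpose_row]
        exact congrFun h (.inl (i, j))
    · rintro ⟨h1, h2⟩
      funext i
      rcases i with ⟨i, j⟩ | ⟨i, j⟩
      · change (U * G.transpose) i j = 0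
        rw [mul_transpose_row]
        exact congrFun (h2 i) j
      · exact congrFun (congrFun h1 i) j
  rw [← h2]
  exact LinearEquiv.finrank_map_eq e _

theorem finrank_range_hgpRight (H : Matrix M A (ZMod 2)) (G : Matrix N B (ZMod 2)) :
    Module.finrank (ZMod 2) (LinearMap.range (hgpRight H G)) +
      Module.finrank (ZMod 2) (LinearMap.ker H.mulVecLin) *
        Module.finrank (ZMod 2) (LinearMap.ker G.transpose.mulVecLin) =
      Fintype.card A * Fintype.card N := by
  have h1 := finrank_range_hgpLeft G H
  have h2 : (LinearMap.range (hgpLeft G H)).map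
      (LinearEquiv.funCongrLeft (ZMod 2) (ZMod 2) hgpSwap).toLinearMap =
      LinearMap.range (hgpRight H G) := by
    ext z
    constructor
    · rintro ⟨_, ⟨U, rfl⟩, rfl⟩
      exact ⟨U.transpose, (hgpRight_comp_swap H G U.transpose).symm⟩
    · rintro ⟨T, rfl⟩
      exact ⟨_, ⟨T.transpose, rfl⟩, hgpRight_comp_swap H G T⟩
  rw [← h2, LinearEquiv.finrank_map_eq]
  linarith

end HypergraphProduct

/-! ### The 4D XYZ product code as a hypergraph product in a frame. -/

section Stabilizer

variable {m₁ m₂ m₃ m₄ nA nB : ℕ}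

namespace CSSCode

variable {mx mz n : ℕ} (C : CSSCode mx mz n)

/-- The order of the qubit blocks forces the first code to be stacked with `Hz` on top and the
second with `Hx` on top; kernels and images on the `n` side do not depend on this order. -/
theorem ker_eq_zx : C.ker = LinearMap.ker (Matrix.fromRows C.Hz C.Hx).mulVecLin := by
  ext v
  simp only [ker, LinearMap.mem_ker, Matrix.mulVecLin_apply, Matrix.fromRows_mulVec]
  constructor <;> intro h <;> funext i <;> rcases i with i | i
  · exact congrFun h (.inr i)
  · exact congrFun h (.inl i)
  · exact congrFun h (.inr i)
  · exact congrFun h (.inl i)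

theorem imT_eq_xz : C.imT = LinearMap.range (Matrix.fromRows C.Hx C.Hz).transpose.mulVecLin := by
  rw [Matrix.transpose_fromRows]; rfl

theorem imT_eq_zx : C.imT = LinearMap.range (Matrix.fromRows C.Hz C.Hx).transpose.mulVecLin := by
  have key : ∀ {a b c : ℕ} (P : Matrix (Fin c) (Fin a) (ZMod 2))
      (R : Matrix (Fin c) (Fin b) (ZMod 2)),
      LinearMap.range (Matrix.fromCols P R).mulVecLin ≤
        LinearMap.range (Matrix.fromCols R P).mulVecLin := by
    rintro a b c P R _ ⟨v, rfl⟩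
    refine ⟨v ∘ Sum.swap, ?_⟩
    simp only [Matrix.mulVecLin_apply, Matrix.fromCols_mulVec]
    exact add_comm _ _
  rw [Matrix.transpose_fromRows]
  exact le_antisymm (key _ _) (key _ _)

theorem kerTZX_eq : C.kerTZX = LinearMap.ker (Matrix.fromRows C.Hz C.Hx).transpose.mulVecLin := by
  rw [Matrix.transpose_fromRows]; rfl

theorem kerTXZ_eq : C.kerTXZ = LinearMap.ker (Matrix.fromRows C.Hx C.Hz).transpose.mulVecLin := by
  rw [Matrix.transpose_fromRows]; rfl

end CSSCode

/-- The five blocks of qubits, arranged as the two blocks of a hypergraph product. -/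
def qubitEquiv : Qubit m₁ m₂ m₃ m₄ nA nB ≃
    ((Fin m₁ ⊕ Fin m₂) × (Fin m₄ ⊕ Fin m₃)) ⊕ (Fin nA × Fin nB) where
  toFun
    | .inl (i, j) => .inl (.inl i, .inl j)
    | .inr (.inl (i, j)) => .inl (.inl i, .inr j)
    | .inr (.inr (.inl p)) => .inr p
    | .inr (.inr (.inr (.inl (i, j)))) => .inl (.inr i, .inl j)
    | .inr (.inr (.inr (.inr (i, j)))) => .inl (.inr i, .inr j)
  invFun
    | .inl (.inl i, .inl j) => .inl (i, j)
    | .inl (.inl i, .inr j) => .inr (.inl (i, j))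
    | .inr p => .inr (.inr (.inl p))
    | .inl (.inr i, .inl j) => .inr (.inr (.inr (.inl (i, j))))
    | .inl (.inr i, .inr j) => .inr (.inr (.inr (.inr (i, j))))
  left_inv := by rintro (_ | _ | _ | _ | _) <;> rfl
  right_inv := by rintro (⟨_ | _, _ | _⟩ | _) <;> rfl

/-- The labels of the generators `genS` and `genV`. -/
def leftLabel : Qubit m₁ m₂ m₃ m₄ nA nB → Pauli1 :=
  Sum.elim (fun _ => .X) (Sum.elim (fun _ => .Y) (Sum.elim (fun _ => .Z)
    (Sum.elim (fun _ => .Y) (fun _ => .X))))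

/-- The labels of the generators `genT` and `genU`. -/
def rightLabel : Qubit m₁ m₂ m₃ m₄ nA nB → Pauli1 :=
  Sum.elim (fun _ => .Y) (Sum.elim (fun _ => .Z) (Sum.elim (fun _ => .X)
    (Sum.elim (fun _ => .Z) (fun _ => .Y))))

theorem isFrame_label : IsFrame (leftLabel (m₁ := m₁) (m₂ := m₂) (m₃ := m₃) (m₄ := m₄)
    (nA := nA) (nB := nB)) rightLabel := by
  rintro (_ | _ | _ | _ | _) <;> simp [leftLabel, rightLabel]

/-- The register of a hypergraph product with the sizes of the 4D XYZ product code. -/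
abbrev HgpVec (m₁ m₂ m₃ m₄ nA nB : ℕ) : Type :=
  ((Fin m₁ ⊕ Fin m₂) × (Fin m₄ ⊕ Fin m₃)) ⊕ (Fin nA × Fin nB) → ZMod 2

/-- Relabelling of the positions of a vector. -/
def toQubit : HgpVec m₁ m₂ m₃ m₄ nA nB ≃ₗ[ZMod 2] (Qubit m₁ m₂ m₃ m₄ nA nB → ZMod 2) :=
  LinearEquiv.funCongrLeft (ZMod 2) (ZMod 2) qubitEquiv

theorem toQubit_dotProduct (z z' : HgpVec m₁ m₂ m₃ m₄ nA nB) :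
    toQubit z ⬝ᵥ toQubit z' = z ⬝ᵥ z' :=
  comp_equiv_dotProduct_comp_equiv z z' qubitEquiv

/-- The operator of the left type with vector `z`. -/
def leftOp (z : HgpVec m₁ m₂ m₃ m₄ nA nB) : (QOp (Qubit m₁ m₂ m₃ m₄ nA nB))ˣ :=
  frameOp leftLabel (toQubit z)

/-- The operator of the right type with vector `z`. -/
def rightOp (z : HgpVec m₁ m₂ m₃ m₄ nA nB) : (QOp (Qubit m₁ m₂ m₃ m₄ nA nB))ˣ :=
  frameOp rightLabel (toQubit z)

theorem leftOp_add (z z' : HgpVec m₁ m₂ m₃ m₄ nA nB) :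
    leftOp (z + z') = leftOp z * leftOp z' := by
  rw [leftOp, map_add, frameOp_add]; rfl

theorem rightOp_add (z z' : HgpVec m₁ m₂ m₃ m₄ nA nB) :
    rightOp (z + z') = rightOp z * rightOp z' := by
  rw [rightOp, map_add, frameOp_add]; rfl

theorem leftOp_zero : leftOp (0 : HgpVec m₁ m₂ m₃ m₄ nA nB) = 1 := by
  rw [leftOp, map_zero, frameOp_zero]

theorem rightOp_zero : rightOp (0 : HgpVec m₁ m₂ m₃ m₄ nA nB) = 1 := by
  rw [rightOp, map_zero, frameOp_zero]

theorem rightOp_mul_leftOp (z' z : HgpVec m₁ m₂ m₃ m₄ nA nB) :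
    rightOp z' * leftOp z = phase _ ^ (2 * (z' ⬝ᵥ z).val) * (leftOp z * rightOp z') := by
  rw [leftOp, rightOp, isFrame_label.symm.mul_comm, toQubit_dotProduct]

theorem leftOp_mul_rightOp (z z' : HgpVec m₁ m₂ m₃ m₄ nA nB) :
    leftOp z * rightOp z' = phase _ ^ (2 * (z ⬝ᵥ z').val) * (rightOp z' * leftOp z) := by
  rw [leftOp, rightOp, isFrame_label.mul_comm, toQubit_dotProduct]

theorem commute_leftOp_rightOp {z z' : HgpVec m₁ m₂ m₃ m₄ nA nB} (h : z ⬝ᵥ z' = 0) :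
    Commute (leftOp z) (rightOp z') := by
  rw [leftOp, rightOp, isFrame_label.commute_iff, toQubit_dotProduct, h]

/-- The names X and Z do not match left and right: on block `C` the letter X is the right label, so
`opXL` is of right type, whereas `opXL2` and `opXL3` are of left type. -/
theorem opXL_eq (r : Fin nA × Fin nB → ZMod 2) :
    (opXL r : (QOp (Qubit m₁ m₂ m₃ m₄ nA nB))ˣ) = rightOp (Sum.elim 0 r) :=
  congrArg pauliOp (by funext q; rcases q with _ | _ | _ | _ | _ <;> rfl)

theorem opZL_eq (w : Fin nA × Fin nB → ZMod 2) :
    (opZL w : (QOp (Qubit m₁ m₂ m₃ m₄ nA nB))ˣ) = leftOp (Sum.elim 0 w) :=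
  congrArg pauliOp (by funext q; rcases q with _ | _ | _ | _ | _ <;> rfl)

theorem opXL2_eq (a : Fin m₁ × Fin m₄ → ZMod 2) (b : Fin m₂ × Fin m₄ → ZMod 2) :
    (opXL2 a b : (QOp (Qubit m₁ m₂ m₃ m₄ nA nB))ˣ) = leftOp (Sum.elim (piPerm a 0 b 0) 0) :=
  congrArg pauliOp (by funext q; rcases q with _ | _ | _ | _ | _ <;> rfl)

theorem opXL3_eq (a : Fin m₁ × Fin m₃ → ZMod 2) (b : Fin m₂ × Fin m₃ → ZMod 2) :
    (opXL3 a b : (QOp (Qubit m₁ m₂ m₃ m₄ nA nB))ˣ) = leftOp (Sum.elim (piPerm 0 a 0 b) 0) :=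
  congrArg pauliOp (by funext q; rcases q with _ | _ | _ | _ | _ <;> rfl)

theorem opZL2_eq (c : Fin m₁ × Fin m₄ → ZMod 2) (d : Fin m₁ × Fin m₃ → ZMod 2) :
    (opZL2 c d : (QOp (Qubit m₁ m₂ m₃ m₄ nA nB))ˣ) = rightOp (Sum.elim (piPerm c d 0 0) 0) :=
  congrArg pauliOp (by funext q; rcases q with _ | _ | _ | _ | _ <;> rfl)

theorem opZL3_eq (c : Fin m₂ × Fin m₄ → ZMod 2) (d : Fin m₂ × Fin m₃ → ZMod 2) :
    (opZL3 c d : (QOp (Qubit m₁ m₂ m₃ m₄ nA nB))ˣ) = rightOp (Sum.elim (piPerm 0 0 c d) 0) :=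
  congrArg pauliOp (by funext q; rcases q with _ | _ | _ | _ | _ <;> rfl)

theorem opXL2_mul_opXL3 (a₁ : Fin m₁ × Fin m₄ → ZMod 2) (a₂ : Fin m₁ × Fin m₃ → ZMod 2)
    (b₁ : Fin m₂ × Fin m₄ → ZMod 2) (b₂ : Fin m₂ × Fin m₃ → ZMod 2) :
    (opXL2 a₁ b₁ * opXL3 a₂ b₂ : (QOp (Qubit m₁ m₂ m₃ m₄ nA nB))ˣ) =
      leftOp (Sum.elim (piPerm a₁ a₂ b₁ b₂) 0) := by
  rw [opXL2_eq, opXL3_eq, ← leftOp_add]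
  congr 1
  funext q
  rcases q with ⟨_ | _, _ | _⟩ | _ <;> simp [piPerm]

theorem opZL2_mul_opZL3 (c₁ : Fin m₁ × Fin m₄ → ZMod 2) (d₁ : Fin m₁ × Fin m₃ → ZMod 2)
    (c₂ : Fin m₂ × Fin m₄ → ZMod 2) (d₂ : Fin m₂ × Fin m₃ → ZMod 2) :
    (opZL2 c₁ d₁ * opZL3 c₂ d₂ : (QOp (Qubit m₁ m₂ m₃ m₄ nA nB))ˣ) =
      rightOp (Sum.elim (piPerm c₁ d₁ c₂ d₂) 0) := by
  rw [opZL2_eq, opZL3_eq, ← rightOp_add]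
  congr 1
  funext q
  rcases q with ⟨_ | _, _ | _⟩ | _ <;> simp [piPerm]

theorem single_mul_apply_one {M N B : Type} [Fintype B] [DecidableEq M] [DecidableEq B]
    (G : Matrix B N (ZMod 2)) (i i' : M) (j : B) (n : N) :
    (Matrix.single i j (1 : ZMod 2) * G) i' n = (1 : Matrix M M (ZMod 2)) i i' * G j n := by
  simp [Matrix.mul_apply, Matrix.single_apply, Matrix.one_apply, ite_and]

theorem mul_single_apply_one {M A N : Type} [Fintype A] [DecidableEq A] [DecidableEq N]
    (H : Matrix M A (ZMod 2)) (i : A) (j n : N) (m : M) :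
    (H * Matrix.single i j (1 : ZMod 2)) m n = H m i * (1 : Matrix N N (ZMod 2)) j n := by
  simp [Matrix.mul_apply, Matrix.single_apply, Matrix.one_apply, ite_and]

variable (C₁ : CSSCode m₂ m₁ nA) (C₂ : CSSCode m₄ m₃ nB)

/-- The left checks of the hypergraph product behind the 4D XYZ product code. -/
def leftChecks : Matrix (Fin m₁ ⊕ Fin m₂) (Fin nB) (ZMod 2) →ₗ[ZMod 2] HgpVec m₁ m₂ m₃ m₄ nA nB :=
  hgpLeft (Matrix.fromRows C₁.Hz C₁.Hx) (Matrix.fromRows C₂.Hx C₂.Hz)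

/-- The right checks of the hypergraph product behind the 4D XYZ product code. -/
def rightChecks :
    Matrix (Fin nA) (Fin m₄ ⊕ Fin m₃) (ZMod 2) →ₗ[ZMod 2] HgpVec m₁ m₂ m₃ m₄ nA nB :=
  hgpRight (Matrix.fromRows C₁.Hz C₁.Hx) (Matrix.fromRows C₂.Hx C₂.Hz)

theorem leftChecks_inl (U : Matrix (Fin m₁ ⊕ Fin m₂) (Fin nB) (ZMod 2))
    (i : Fin m₁ ⊕ Fin m₂) (j : Fin m₄ ⊕ Fin m₃) :
    leftChecks C₁ C₂ U (.inl (i, j)) = (U * (Matrix.fromRows C₂.Hx C₂.Hz).transpose) i j := rfl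

theorem leftChecks_inr (U : Matrix (Fin m₁ ⊕ Fin m₂) (Fin nB) (ZMod 2)) (i : Fin nA) (j : Fin nB) :
    leftChecks C₁ C₂ U (.inr (i, j)) = ((Matrix.fromRows C₁.Hz C₁.Hx).transpose * U) i j := rfl

theorem rightChecks_inl (T : Matrix (Fin nA) (Fin m₄ ⊕ Fin m₃) (ZMod 2))
    (i : Fin m₁ ⊕ Fin m₂) (j : Fin m₄ ⊕ Fin m₃) :
    rightChecks C₁ C₂ T (.inl (i, j)) = (Matrix.fromRows C₁.Hz C₁.Hx * T) i j := rfl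

theorem rightChecks_inr (T : Matrix (Fin nA) (Fin m₄ ⊕ Fin m₃) (ZMod 2)) (i : Fin nA)
    (j : Fin nB) :
    rightChecks C₁ C₂ T (.inr (i, j)) = (T * Matrix.fromRows C₂.Hx C₂.Hz) i j := rfl

/-- Each generator is the check of a matrix unit: multiplying by a matrix unit produces the rows of
the Kronecker products with the identity. Matrix units span, so the generators yield all checks. -/
theorem genS_eq (p : Fin m₁ × Fin nB) :
    genS C₁ C₂ p = leftOp (leftChecks C₁ C₂ (Matrix.single (.inl p.1) p.2 1)) := by
  obtain ⟨s, b⟩ := p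
  refine congrArg pauliOp ?_
  funext q
  rcases q with ⟨i, j⟩ | ⟨i, j⟩ | ⟨i, j⟩ | ⟨i, j⟩ | ⟨i, j⟩ <;>
    simp [pauliVec, Pauli1.bit, toQubit, qubitEquiv, leftLabel, LinearMap.funLeft_apply,
      leftChecks_inl, leftChecks_inr, single_mul_apply_one, mul_single_apply_one,
      Matrix.one_apply, Matrix.kroneckerMap_apply]

theorem genV_eq (p : Fin m₂ × Fin nB) :
    genV C₁ C₂ p = leftOp (leftChecks C₁ C₂ (Matrix.single (.inr p.1) p.2 1)) := by
  obtain ⟨s, b⟩ := p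
  refine congrArg pauliOp ?_
  funext q
  rcases q with ⟨i, j⟩ | ⟨i, j⟩ | ⟨i, j⟩ | ⟨i, j⟩ | ⟨i, j⟩ <;>
    simp [pauliVec, Pauli1.bit, toQubit, qubitEquiv, leftLabel, LinearMap.funLeft_apply,
      leftChecks_inl, leftChecks_inr, single_mul_apply_one, mul_single_apply_one,
      Matrix.one_apply, Matrix.kroneckerMap_apply]

theorem genT_eq (p : Fin nA × Fin m₄) :
    genT C₁ C₂ p = rightOp (rightChecks C₁ C₂ (Matrix.single p.1 (.inl p.2) 1)) := by
  obtain ⟨s, b⟩ := p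
  refine congrArg pauliOp ?_
  funext q
  rcases q with ⟨i, j⟩ | ⟨i, j⟩ | ⟨i, j⟩ | ⟨i, j⟩ | ⟨i, j⟩ <;>
    simp [pauliVec, Pauli1.bit, toQubit, qubitEquiv, rightLabel, LinearMap.funLeft_apply,
      rightChecks_inl, rightChecks_inr, mul_single_apply_one, single_mul_apply_one,
      Matrix.one_apply, Matrix.kroneckerMap_apply]

theorem genU_eq (p : Fin nA × Fin m₃) :
    genU C₁ C₂ p = rightOp (rightChecks C₁ C₂ (Matrix.single p.1 (.inr p.2) 1)) := by
  obtain ⟨s, b⟩ := p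
  refine congrArg pauliOp ?_
  funext q
  rcases q with ⟨i, j⟩ | ⟨i, j⟩ | ⟨i, j⟩ | ⟨i, j⟩ | ⟨i, j⟩ <;>
    simp [pauliVec, Pauli1.bit, toQubit, qubitEquiv, rightLabel, LinearMap.funLeft_apply,
      rightChecks_inl, rightChecks_inr, mul_single_apply_one, single_mul_apply_one,
      Matrix.one_apply, Matrix.kroneckerMap_apply]

theorem span_range_comp_single {M B E : Type} [Fintype M] [Fintype B] [DecidableEq M]
    [DecidableEq B] [AddCommGroup E] [Module (ZMod 2) E] (φ : Matrix M B (ZMod 2) →ₗ[ZMod 2] E) :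
    Submodule.span (ZMod 2) (Set.range fun p : M × B => φ (Matrix.single p.1 p.2 1)) =
      LinearMap.range φ := by
  have h := congrArg (Submodule.map φ) (Matrix.stdBasis (ZMod 2) M B).span_eq
  rw [Submodule.map_span, ← Set.range_comp, Submodule.map_top] at h
  rw [← h]
  congr 2
  funext p
  rw [Function.comp_apply, Matrix.stdBasis_eq_single]

theorem isFrameStabilizer_xyz :
    IsFrameStabilizer leftLabel rightLabel
      (LinearMap.range (toQubit.toLinearMap ∘ₗ leftChecks C₁ C₂))
      (LinearMap.range (toQubit.toLinearMap ∘ₗ rightChecks C₁ C₂)) (xyzStabilizer C₁ C₂) := by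
  have horth : ∀ U T, (toQubit.toLinearMap ∘ₗ leftChecks C₁ C₂) U ⬝ᵥ
      (toQubit.toLinearMap ∘ₗ rightChecks C₁ C₂) T = 0 := by
    intro U T
    exact (toQubit_dotProduct _ _).trans (hgpLeft_dotProduct_hgpRight _ _ U T)
  refine ⟨isFrame_label, ?_, fun x => ?_⟩
  · rintro _ ⟨U, rfl⟩ _ ⟨T, rfl⟩
    exact horth U T
  · rw [← span_range_comp_single, ← span_range_comp_single, ← isFrame_label.mem_closure_iff,
      xyzStabilizer]
    · suffices h : Set.range (genS C₁ C₂) ∪ Set.range (genT C₁ C₂) ∪ Set.range (genU C₁ C₂) ∪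
          Set.range (genV C₁ C₂) = _ by rw [h]
      rw [← Set.range_comp, ← Set.range_comp]
      ext y
      constructor
      · rintro (((⟨p, rfl⟩ | ⟨p, rfl⟩) | ⟨p, rfl⟩) | ⟨p, rfl⟩)
        · exact Or.inl ⟨(.inl p.1, p.2), (genS_eq C₁ C₂ p).symm⟩
        · exact Or.inr ⟨(p.1, .inl p.2), (genT_eq C₁ C₂ p).symm⟩
        · exact Or.inr ⟨(p.1, .inr p.2), (genU_eq C₁ C₂ p).symm⟩
        · exact Or.inl ⟨(.inr p.1, p.2), (genV_eq C₁ C₂ p).symm⟩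
      · rintro (⟨⟨i | i, j⟩, rfl⟩ | ⟨⟨i, j | j⟩, rfl⟩)
        · exact Or.inl (Or.inl (Or.inl ⟨(i, j), genS_eq C₁ C₂ (i, j)⟩))
        · exact Or.inr ⟨(i, j), genV_eq C₁ C₂ (i, j)⟩
        · exact Or.inl (Or.inl (Or.inr ⟨(i, j), genT_eq C₁ C₂ (i, j)⟩))
        · exact Or.inl (Or.inr ⟨(i, j), genU_eq C₁ C₂ (i, j)⟩)
    · rintro _ ⟨p, rfl⟩ _ ⟨p', rfl⟩
      exact horth _ _

end Stabilizer

/-! ### Logical operators from tensor products of kernels and complements, and the block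
rearrangement. -/

section LogicalOperators

theorem IsLogical.phase_mul_mul {Q : Type} [Fintype Q] [DecidableEq Q] {S : Subgroup (QOp Q)ˣ}
    {P g : (QOp Q)ˣ} (hP : IsLogical S P) (hS : S ≤ pauliGroup Q)
    (hc : ∀ g ∈ S, ∀ h ∈ S, Commute g h) (n : ℕ) (hg : g ∈ S) :
    IsLogical S (phase Q ^ n * g * P) where
  mem_pauliGroup := mul_mem (mul_mem (phase_pow_mem_pauliGroup n) (hS hg)) hP.mem_pauliGroup
  commute x hx := (((phase_pow_commute n x).symm).mul_right (hc x hx g hg)).mul_right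
    (hP.commute x hx)
  notMem m hm := by
    refine hP.notMem (m + n) ?_
    have e : phase Q ^ (m + n) * P = g⁻¹ * (phase Q ^ m * (phase Q ^ n * g * P)) := by
      rw [← mul_assoc (phase Q ^ m), ← mul_assoc (phase Q ^ m), ← pow_add,
        (phase_pow_commute (m + n) g).eq]
      group
    rw [e]
    exact mul_mem (inv_mem hg) hm

variable {m₁ m₂ m₃ m₄ nA nB : ℕ}

theorem toQubit_mem_range_iff {E : Type} [AddCommGroup E] [Module (ZMod 2) E]
    (φ : E →ₗ[ZMod 2] HgpVec m₁ m₂ m₃ m₄ nA nB) (z : HgpVec m₁ m₂ m₃ m₄ nA nB) :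
    toQubit z ∈ LinearMap.range (toQubit.toLinearMap ∘ₗ φ) ↔ z ∈ LinearMap.range φ := by
  constructor
  · rintro ⟨U, hU⟩
    exact ⟨U, toQubit.injective hU⟩
  · rintro ⟨U, rfl⟩
    exact ⟨U, rfl⟩

theorem orthogonal_range_iff {E : Type} [AddCommGroup E] [Module (ZMod 2) E]
    (φ : E →ₗ[ZMod 2] HgpVec m₁ m₂ m₃ m₄ nA nB) (z : HgpVec m₁ m₂ m₃ m₄ nA nB) :
    (∀ u ∈ LinearMap.range (toQubit.toLinearMap ∘ₗ φ), toQubit z ⬝ᵥ u = 0) ↔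
      ∀ U, z ⬝ᵥ φ U = 0 := by
  constructor
  · intro h U
    rw [← toQubit_dotProduct]
    exact h _ ⟨U, rfl⟩
  · rintro h _ ⟨U, rfl⟩
    exact (toQubit_dotProduct _ _).trans (h U)

theorem isLogical_xyz_iff (C₁ : CSSCode m₂ m₁ nA) (C₂ : CSSCode m₄ m₃ nB)
    (n : ℕ) (z z' : HgpVec m₁ m₂ m₃ m₄ nA nB) :
    IsLogical (xyzStabilizer C₁ C₂) (phase _ ^ n * (leftOp z * rightOp z')) ↔
      ((∀ T, z ⬝ᵥ rightChecks C₁ C₂ T = 0) ∧ ∀ U, z' ⬝ᵥ leftChecks C₁ C₂ U = 0) ∧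
        ¬ (z ∈ LinearMap.range (leftChecks C₁ C₂) ∧ z' ∈ LinearMap.range (rightChecks C₁ C₂)) := by
  rw [leftOp, rightOp, (isFrameStabilizer_xyz C₁ C₂).isLogical_iff, orthogonal_range_iff,
    orthogonal_range_iff, toQubit_mem_range_iff, toQubit_mem_range_iff]

theorem sumElim_zero : (Sum.elim 0 0 : HgpVec m₁ m₂ m₃ m₄ nA nB) = 0 := by
  funext i; rcases i with i | i <;> rfl

/-- Complements of the images of the four matrices of a pair of CSS codes. -/
structure IsComplFamily (C₁ : CSSCode m₂ m₁ nA) (C₂ : CSSCode m₄ m₃ nB)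
    (WA : Submodule (ZMod 2) (Fin nA → ZMod 2)) (WB : Submodule (ZMod 2) (Fin nB → ZMod 2))
    (W₁ : Submodule (ZMod 2) (Fin m₁ ⊕ Fin m₂ → ZMod 2))
    (W₂ : Submodule (ZMod 2) (Fin m₄ ⊕ Fin m₃ → ZMod 2)) : Prop where
  left : IsCompl WA C₁.imT
  right : IsCompl WB C₂.imT
  leftT : IsCompl W₁ C₁.imZX
  rightT : IsCompl W₂ C₂.imXZ

namespace IsComplFamily

variable {C₁ : CSSCode m₂ m₁ nA} {C₂ : CSSCode m₄ m₃ nB}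
  {WA : Submodule (ZMod 2) (Fin nA → ZMod 2)} {WB : Submodule (ZMod 2) (Fin nB → ZMod 2)}
  {W₁ : Submodule (ZMod 2) (Fin m₁ ⊕ Fin m₂ → ZMod 2)}
  {W₂ : Submodule (ZMod 2) (Fin m₄ ⊕ Fin m₃ → ZMod 2)}

theorem orthogonal_rightChecks_iff (h : IsComplFamily C₁ C₂ WA WB W₁ W₂)
    (z : HgpVec m₁ m₂ m₃ m₄ nA nB) :
    (∀ T, z ⬝ᵥ rightChecks C₁ C₂ T = 0) ↔
      ∃ U, ∃ x ∈ tensorSub C₁.kerTZX W₂, ∃ y ∈ tensorSub WA C₂.ker,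
        z = leftChecks C₁ C₂ U + Sum.elim x y := by
  rw [C₁.kerTZX_eq]
  exact orthogonal_hgpRight_iff _ _ (C₁.imT_eq_zx ▸ h.left) h.rightT z

theorem orthogonal_leftChecks_iff (h : IsComplFamily C₁ C₂ WA WB W₁ W₂)
    (z : HgpVec m₁ m₂ m₃ m₄ nA nB) :
    (∀ U, z ⬝ᵥ leftChecks C₁ C₂ U = 0) ↔
      ∃ T, ∃ x ∈ tensorSub W₁ C₂.kerTXZ, ∃ y ∈ tensorSub C₁.ker WB,
        z = rightChecks C₁ C₂ T + Sum.elim x y := by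
  rw [C₂.kerTXZ_eq, C₁.ker_eq_zx]
  exact orthogonal_hgpLeft_iff _ _ h.leftT (C₂.imT_eq_xz ▸ h.right) z

theorem eq_zero_of_mem_leftChecks (h : IsComplFamily C₁ C₂ WA WB W₁ W₂)
    {x : (Fin m₁ ⊕ Fin m₂) × (Fin m₄ ⊕ Fin m₃) → ZMod 2} {y : Fin nA × Fin nB → ZMod 2}
    (hx : x ∈ tensorSub C₁.kerTZX W₂) (hy : y ∈ tensorSub WA C₂.ker)
    (hxy : Sum.elim x y ∈ LinearMap.range (leftChecks C₁ C₂)) : x = 0 ∧ y = 0 := by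
  rw [C₁.kerTZX_eq] at hx
  exact eq_zero_of_mem_range_hgpLeft _ _ (C₁.imT_eq_zx ▸ h.left) h.rightT hx hy hxy

theorem eq_zero_of_mem_rightChecks (h : IsComplFamily C₁ C₂ WA WB W₁ W₂)
    {x : (Fin m₁ ⊕ Fin m₂) × (Fin m₄ ⊕ Fin m₃) → ZMod 2} {y : Fin nA × Fin nB → ZMod 2}
    (hx : x ∈ tensorSub W₁ C₂.kerTXZ) (hy : y ∈ tensorSub C₁.ker WB)
    (hxy : Sum.elim x y ∈ LinearMap.range (rightChecks C₁ C₂)) : x = 0 ∧ y = 0 := by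
  rw [C₂.kerTXZ_eq] at hx
  rw [C₁.ker_eq_zx] at hy
  exact eq_zero_of_mem_range_hgpRight _ _ h.leftT (C₂.imT_eq_xz ▸ h.right) hx hy hxy

theorem orthogonal (h : IsComplFamily C₁ C₂ WA WB W₁ W₂)
    {x x' : (Fin m₁ ⊕ Fin m₂) × (Fin m₄ ⊕ Fin m₃) → ZMod 2} {y y' : Fin nA × Fin nB → ZMod 2}
    (hx : x ∈ tensorSub C₁.kerTZX W₂) (hy : y ∈ tensorSub WA C₂.ker)
    (hx' : x' ∈ tensorSub W₁ C₂.kerTXZ) (hy' : y' ∈ tensorSub C₁.ker WB) :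
    (∀ T, Sum.elim x y ⬝ᵥ rightChecks C₁ C₂ T = 0) ∧
      ∀ U, Sum.elim x' y' ⬝ᵥ leftChecks C₁ C₂ U = 0 :=
  ⟨(h.orthogonal_rightChecks_iff _).mpr ⟨0, x, hx, y, hy, by rw [map_zero, zero_add]⟩,
    (h.orthogonal_leftChecks_iff _).mpr ⟨0, x', hx', y', hy', by rw [map_zero, zero_add]⟩⟩

/-- Such vectors are cycles, and one that is also a boundary vanishes, so a nonzero choice is never
in the stabilizer. -/
theorem isLogical (h : IsComplFamily C₁ C₂ WA WB W₁ W₂)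
    {x x' : (Fin m₁ ⊕ Fin m₂) × (Fin m₄ ⊕ Fin m₃) → ZMod 2} {y y' : Fin nA × Fin nB → ZMod 2}
    (hx : x ∈ tensorSub C₁.kerTZX W₂) (hy : y ∈ tensorSub WA C₂.ker)
    (hx' : x' ∈ tensorSub W₁ C₂.kerTXZ) (hy' : y' ∈ tensorSub C₁.ker WB)
    (hne : ¬ (x = 0 ∧ y = 0 ∧ x' = 0 ∧ y' = 0)) :
    IsLogical (xyzStabilizer C₁ C₂) (leftOp (Sum.elim x y) * rightOp (Sum.elim x' y')) := by
  have h1 := (isLogical_xyz_iff C₁ C₂ 0 (Sum.elim x y) (Sum.elim x' y')).mpr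
  rw [pow_zero, one_mul] at h1
  refine h1 ⟨h.orthogonal hx hy hx' hy', fun h2 => hne ?_⟩
  obtain ⟨h3, h4⟩ := h.eq_zero_of_mem_leftChecks hx hy h2.1
  exact ⟨h3, h4, h.eq_zero_of_mem_rightChecks hx' hy' h2.2⟩

theorem isLogical_opXL (h : IsComplFamily C₁ C₂ WA WB W₁ W₂) {r : Fin nA × Fin nB → ZMod 2}
    (hr : r ∈ tensorSub C₁.ker WB) (h0 : r ≠ 0) : IsLogical (xyzStabilizer C₁ C₂) (opXL r) := by
  have := h.isLogical (zero_mem _) (zero_mem _) (zero_mem _) hr fun h1 => h0 h1.2.2.2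
  rwa [sumElim_zero, leftOp_zero, one_mul, ← opXL_eq] at this

theorem isLogical_opZL (h : IsComplFamily C₁ C₂ WA WB W₁ W₂) {w : Fin nA × Fin nB → ZMod 2}
    (hw : w ∈ tensorSub WA C₂.ker) (h0 : w ≠ 0) : IsLogical (xyzStabilizer C₁ C₂) (opZL w) := by
  have := h.isLogical (zero_mem _) hw (zero_mem _) (zero_mem _) fun h1 => h0 h1.2.1
  rwa [sumElim_zero, rightOp_zero, mul_one, ← opZL_eq] at this

theorem isLogical_leftOp (h : IsComplFamily C₁ C₂ WA WB W₁ W₂)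
    {x : (Fin m₁ ⊕ Fin m₂) × (Fin m₄ ⊕ Fin m₃) → ZMod 2}
    (hx : x ∈ tensorSub C₁.kerTZX W₂) (h0 : x ≠ 0) :
    IsLogical (xyzStabilizer C₁ C₂) (leftOp (Sum.elim x 0)) := by
  have := h.isLogical hx (zero_mem _) (zero_mem _) (zero_mem _) fun h1 => h0 h1.1
  rwa [sumElim_zero, rightOp_zero, mul_one] at this

theorem isLogical_rightOp (h : IsComplFamily C₁ C₂ WA WB W₁ W₂)
    {x : (Fin m₁ ⊕ Fin m₂) × (Fin m₄ ⊕ Fin m₃) → ZMod 2}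
    (hx : x ∈ tensorSub W₁ C₂.kerTXZ) (h0 : x ≠ 0) :
    IsLogical (xyzStabilizer C₁ C₂) (rightOp (Sum.elim x 0)) := by
  have := h.isLogical (zero_mem _) (zero_mem _) hx (zero_mem _) fun h1 => h0 h1.2.2.1
  rwa [sumElim_zero, leftOp_zero, one_mul] at this

end IsComplFamily

section PiPerm

variable {α β γ δ : Type} {a₁ : α × γ → ZMod 2} {a₂ : α × δ → ZMod 2} {b₁ : β × γ → ZMod 2}
  {b₂ : β × δ → ZMod 2}

theorem piPerm_eq_zero_iff : piPerm a₁ a₂ b₁ b₂ = 0 ↔ a₁ = 0 ∧ a₂ = 0 ∧ b₁ = 0 ∧ b₂ = 0 := by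
  constructor
  · intro h
    exact ⟨funext fun p => congrFun h (.inl p.1, .inl p.2),
      funext fun p => congrFun h (.inl p.1, .inr p.2),
      funext fun p => congrFun h (.inr p.1, .inl p.2),
      funext fun p => congrFun h (.inr p.1, .inr p.2)⟩
  · rintro ⟨rfl, rfl, rfl, rfl⟩
    funext ⟨i, j⟩
    rcases i with i | i <;> rcases j with j | j <;> rfl

theorem piPerm_blocks (x : (α ⊕ β) × (γ ⊕ δ) → ZMod 2) :
    piPerm (fun p => x (.inl p.1, .inl p.2)) (fun p => x (.inl p.1, .inr p.2))
      (fun p => x (.inr p.1, .inl p.2)) (fun p => x (.inr p.1, .inr p.2)) = x := by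
  funext ⟨i, j⟩
  rcases i with i | i <;> rcases j with j | j <;> rfl

theorem elim_inr_mem_of_isBlockAdapted {W : Submodule (ZMod 2) (α ⊕ β → ZMod 2)}
    (hW : IsBlockAdapted W) {y : α ⊕ β → ZMod 2} (hy : y ∈ W) :
    Sum.elim (fun _ => 0) (fun i => y (Sum.inr i)) ∈ W := by
  convert W.sub_mem hy (hW y hy) using 1
  funext i
  rcases i with i | i <;> simp

/-- The two column blocks of an element of `K ⊗ W`, for `W` adapted to the blocks. -/
theorem piPerm_mem_right [Fintype α] [Fintype β] [Fintype γ] [Fintype δ]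
    {K : Submodule (ZMod 2) (α ⊕ β → ZMod 2)}
    {W : Submodule (ZMod 2) (γ ⊕ δ → ZMod 2)} (hW : IsBlockAdapted W)
    (h : piPerm a₁ a₂ b₁ b₂ ∈ tensorSub K W) :
    piPerm a₁ 0 b₁ 0 ∈ tensorSub K W ∧ piPerm 0 a₂ 0 b₂ ∈ tensorSub K W := by
  simp only [mem_tensorSub_iff] at h ⊢
  obtain ⟨h1, h2⟩ := h
  have hz : (fun _ => 0 : α ⊕ β → ZMod 2) ∈ K := zero_mem K
  refine ⟨⟨?_, fun i => ?_⟩, ?_, fun i => ?_⟩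
  · rintro (j | j)
    · convert h1 (.inl j) using 1
      funext i; rcases i with i | i <;> rfl
    · convert hz using 1
      funext i; rcases i with i | i <;> rfl
  · convert hW _ (h2 i) using 1
    funext j; rcases i with i | i <;> rcases j with j | j <;> rfl
  · rintro (j | j)
    · convert hz using 1
      funext i; rcases i with i | i <;> rfl
    · convert h1 (.inr j) using 1
      funext i; rcases i with i | i <;> rfl
  · convert elim_inr_mem_of_isBlockAdapted hW (h2 i) using 1
    funext j; rcases i with i | i <;> rcases j with j | j <;> rfl

/-- The two row blocks of an element of `W ⊗ K`, for `W` adapted to the blocks. -/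
theorem piPerm_mem_left [Fintype α] [Fintype β] [Fintype γ] [Fintype δ]
    {W : Submodule (ZMod 2) (α ⊕ β → ZMod 2)}
    {K : Submodule (ZMod 2) (γ ⊕ δ → ZMod 2)} (hW : IsBlockAdapted W)
    (h : piPerm a₁ a₂ b₁ b₂ ∈ tensorSub W K) :
    piPerm a₁ a₂ 0 0 ∈ tensorSub W K ∧ piPerm 0 0 b₁ b₂ ∈ tensorSub W K := by
  simp only [mem_tensorSub_iff] at h ⊢
  obtain ⟨h1, h2⟩ := h
  have hz : (fun _ => 0 : γ ⊕ δ → ZMod 2) ∈ K := zero_mem K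
  refine ⟨⟨fun j => ?_, ?_⟩, fun j => ?_, ?_⟩
  · convert hW _ (h1 j) using 1
    funext i; rcases i with i | i <;> rcases j with j | j <;> rfl
  · rintro (i | i)
    · convert h2 (.inl i) using 1
      funext j; rcases j with j | j <;> rfl
    · convert hz using 1
      funext j; rcases j with j | j <;> rfl
  · convert elim_inr_mem_of_isBlockAdapted hW (h1 j) using 1
    funext i; rcases i with i | i <;> rcases j with j | j <;> rfl
  · rintro (i | i)
    · convert hz using 1
      funext j; rcases j with j | j <;> rfl
    · convert h2 (.inr i) using 1
      funext j; rcases j with j | j <;> rfl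

end PiPerm

end LogicalOperators

/-! ### Number of encoded qubits. -/

section Parameters

variable {m₁ m₂ m₃ m₄ nA nB : ℕ}

/-- Row rank equals column rank. -/
theorem finrank_ker_add_card {ι κ : Type} [Fintype ι] [Fintype κ]
    (H : Matrix ι κ (ZMod 2)) :
    (Module.finrank (ZMod 2) (LinearMap.ker H.mulVecLin) : ℤ) + Fintype.card ι =
      Module.finrank (ZMod 2) (LinearMap.ker H.transpose.mulVecLin) + Fintype.card κ := by
  have h1 := LinearMap.finrank_range_add_finrank_ker H.mulVecLin
  have h2 := LinearMap.finrank_range_add_finrank_ker H.transpose.mulVecLin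
  have h3 : Module.finrank (ZMod 2) (LinearMap.range H.transpose.mulVecLin) =
    Module.finrank (ZMod 2) (LinearMap.range H.mulVecLin) := Matrix.rank_transpose H
  rw [Module.finrank_fintype_fun_eq_card] at h1 h2
  omega

variable (C₁ : CSSCode m₂ m₁ nA) (C₂ : CSSCode m₄ m₃ nB)

theorem finrank_ker_left :
    (Module.finrank (ZMod 2) C₁.ker : ℤ) + (m₁ + m₂) = Module.finrank (ZMod 2) C₁.kerTZX + nA := by
  have h := finrank_ker_add_card (Matrix.fromRows C₁.Hz C₁.Hx)
  rw [C₁.ker_eq_zx, C₁.kerTZX_eq]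
  simpa using h

theorem finrank_ker_right :
    (Module.finrank (ZMod 2) C₂.ker : ℤ) + (m₄ + m₃) = Module.finrank (ZMod 2) C₂.kerTXZ + nB := by
  have h := finrank_ker_add_card (Matrix.fromRows C₂.Hx C₂.Hz)
  have e : C₂.ker = LinearMap.ker (Matrix.fromRows C₂.Hx C₂.Hz).mulVecLin := rfl
  rw [C₂.kerTXZ_eq, e]
  simpa using h

theorem isStabilizerCode_xyz :
    IsStabilizerCode (xyzStabilizer C₁ C₂)
      (Module.finrank (ZMod 2) C₁.ker * Module.finrank (ZMod 2) C₂.ker +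
        Module.finrank (ZMod 2) C₁.kerTZX * Module.finrank (ZMod 2) C₂.kerTXZ) := by
  refine (isFrameStabilizer_xyz C₁ C₂).isStabilizerCode ?_
  have hr : ∀ {E : Type} [AddCommGroup E] [Module (ZMod 2) E]
      (φ : E →ₗ[ZMod 2] HgpVec m₁ m₂ m₃ m₄ nA nB),
      Module.finrank (ZMod 2) (LinearMap.range (toQubit.toLinearMap ∘ₗ φ)) =
        Module.finrank (ZMod 2) (LinearMap.range φ) := by
    intro E _ _ φ
    rw [LinearMap.range_comp]
    exact LinearEquiv.finrank_map_eq toQubit _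
  rw [hr, hr, Fintype.card_congr qubitEquiv]
  have h1 := finrank_range_hgpLeft (Matrix.fromRows C₁.Hz C₁.Hx) (Matrix.fromRows C₂.Hx C₂.Hz)
  have h2 := finrank_range_hgpRight (Matrix.fromRows C₁.Hz C₁.Hx) (Matrix.fromRows C₂.Hx C₂.Hz)
  rw [← C₁.kerTZX_eq] at h1
  rw [← C₁.ker_eq_zx, ← C₂.kerTXZ_eq] at h2
  change _ + _ * Module.finrank (ZMod 2) C₂.ker = _ at h1
  have h3 := finrank_ker_left C₁
  have h4 := finrank_ker_right C₂
  simp only [Fintype.card_sum, Fintype.card_prod, Fintype.card_fin] at h1 h2 ⊢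
  unfold leftChecks rightChecks
  generalize Module.finrank (ZMod 2) C₁.ker = x at *
  generalize Module.finrank (ZMod 2) C₂.ker = y at *
  generalize Module.finrank (ZMod 2) C₁.kerTZX = u at *
  generalize Module.finrank (ZMod 2) C₂.kerTXZ = v at *
  zify at h1 h2 ⊢
  -- Eliminating `x` and `y` reduces the count to `x y + u v - u y - x v = (x - u)(y - v)`, where
  -- both factors are differences of matrix sizes.
  have hx : (x : ℤ) = u + nA - (m₁ + m₂) := by linarith
  have hy : (y : ℤ) = v + nB - (m₄ + m₃) := by linarith
  rw [hx] at h2 ⊢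
  rw [hy] at h1 ⊢
  linear_combination h1 + h2

theorem dimension_eq :
    ((Module.finrank (ZMod 2) C₁.ker * Module.finrank (ZMod 2) C₂.ker +
      Module.finrank (ZMod 2) C₁.kerTZX * Module.finrank (ZMod 2) C₂.kerTXZ : ℕ) : ℤ) =
      ((nA : ℤ) - m₁ - m₂) * ((nB : ℤ) - m₃ - m₄) +
        Module.finrank (ZMod 2) (tensorSub C₁.kerTZX C₂.ker) +
        Module.finrank (ZMod 2) (tensorSub C₁.ker C₂.kerTXZ) := by
  have h3 := finrank_ker_left C₁
  have h4 := finrank_ker_right C₂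
  rw [finrank_tensorSub, finrank_tensorSub]
  push_cast
  have hA : (nA : ℤ) - m₁ - m₂ =
      Module.finrank (ZMod 2) C₁.ker - Module.finrank (ZMod 2) C₁.kerTZX := by linarith
  have hB : (nB : ℤ) - m₃ - m₄ =
      Module.finrank (ZMod 2) C₂.ker - Module.finrank (ZMod 2) C₂.kerTXZ := by linarith
  rw [hA, hB]
  ring

end Parameters

/-! ### Every logical operator is a product of the two types. -/

section Completeness

variable {m₁ m₂ m₃ m₄ nA nB : ℕ} {C₁ : CSSCode m₂ m₁ nA} {C₂ : CSSCode m₄ m₃ nB}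
  {WA : Submodule (ZMod 2) (Fin nA → ZMod 2)} {WB : Submodule (ZMod 2) (Fin nB → ZMod 2)}
  {W₁ : Submodule (ZMod 2) (Fin m₁ ⊕ Fin m₂ → ZMod 2)}
  {W₂ : Submodule (ZMod 2) (Fin m₄ ⊕ Fin m₃ → ZMod 2)}

/-- Bringing the product to normal form moves the right string of `r` past left strings. It is
supported on block `C`, where only `w` lives, so the sign is that of `r ⬝ᵥ w`. -/
theorem logical_product_eq (r w : Fin nA × Fin nB → ZMod 2) (a₁ : Fin m₁ × Fin m₄ → ZMod 2)
    (a₂ : Fin m₁ × Fin m₃ → ZMod 2) (b₁ : Fin m₂ × Fin m₄ → ZMod 2)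
    (b₂ : Fin m₂ × Fin m₃ → ZMod 2) (c₁ : Fin m₁ × Fin m₄ → ZMod 2)
    (d₁ : Fin m₁ × Fin m₃ → ZMod 2) (c₂ : Fin m₂ × Fin m₄ → ZMod 2)
    (d₂ : Fin m₂ × Fin m₃ → ZMod 2) :
    (opXL r * opZL w * (opXL2 a₁ b₁ * opXL3 a₂ b₂) * (opZL2 c₁ d₁ * opZL3 c₂ d₂) :
      (QOp (Qubit m₁ m₂ m₃ m₄ nA nB))ˣ) =
      phase _ ^ (2 * (r ⬝ᵥ w).val) * (leftOp (Sum.elim (piPerm a₁ a₂ b₁ b₂) w) *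
        rightOp (Sum.elim (piPerm c₁ d₁ c₂ d₂) r)) := by
  rw [opXL2_mul_opXL3, opZL2_mul_opZL3, opXL_eq, opZL_eq, mul_assoc (rightOp _), ← leftOp_add,
    rightOp_mul_leftOp, mul_assoc, mul_assoc (leftOp _), ← rightOp_add]
  have e : ∀ (x : (Fin m₁ ⊕ Fin m₂) × (Fin m₄ ⊕ Fin m₃) → ZMod 2) (y : Fin nA × Fin nB → ZMod 2),
      (Sum.elim 0 y : HgpVec m₁ m₂ m₃ m₄ nA nB) + Sum.elim x 0 = Sum.elim x y := by
    intro x y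
    funext i
    rcases i with i | i <;> simp
  rw [e, e, sumElim_dotProduct_sumElim, zero_dotProduct, zero_add]

theorem phase_pow_two_mul_mul_self {Q : Type} [Fintype Q] [DecidableEq Q] (n : ℕ) :
    phase Q ^ (2 * n) * phase Q ^ (2 * n) = 1 := by
  rw [← pow_add, show 2 * n + 2 * n = 4 * n by ring, pow_mul, phase_pow_four, one_pow]

theorem IsComplFamily.isLogical_iff_exists (h : IsComplFamily C₁ C₂ WA WB W₁ W₂)
    (P : (QOp (Qubit m₁ m₂ m₃ m₄ nA nB))ˣ) :
    IsLogical (xyzStabilizer C₁ C₂) P ↔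
      ∃ r ∈ tensorSub C₁.ker WB, ∃ w ∈ tensorSub WA C₂.ker, ∃ a₁ a₂ b₁ b₂ c₁ d₁ c₂ d₂,
        piPerm a₁ a₂ b₁ b₂ ∈ tensorSub C₁.kerTZX W₂ ∧
        piPerm c₁ d₁ c₂ d₂ ∈ tensorSub W₁ C₂.kerTXZ ∧
        (r ≠ 0 ∨ w ≠ 0 ∨ piPerm a₁ a₂ b₁ b₂ ≠ 0 ∨ piPerm c₁ d₁ c₂ d₂ ≠ 0) ∧
        ∃ (n : ℕ), ∃ g ∈ xyzStabilizer C₁ C₂, P = phase _ ^ n * g * (opXL r * opZL w *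
          (opXL2 a₁ b₁ * opXL3 a₂ b₂) * (opZL2 c₁ d₁ * opZL3 c₂ d₂)) := by
  constructor
  · intro hP
    obtain ⟨n, v, v', hv⟩ := isFrame_label.exists_eq_of_mem_pauliGroup hP.mem_pauliGroup
    obtain ⟨z, rfl⟩ := toQubit.surjective v
    obtain ⟨z', rfl⟩ := toQubit.surjective v'
    change P = phase _ ^ n * (leftOp z * rightOp z') at hv
    subst hv
    obtain ⟨⟨h1, h2⟩, hne⟩ := (isLogical_xyz_iff C₁ C₂ n z z').mp hP
    obtain ⟨U, x, hx, w, hw, rfl⟩ := (h.orthogonal_rightChecks_iff z).mp h1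
    obtain ⟨T, x', hx', r, hr, rfl⟩ := (h.orthogonal_leftChecks_iff z').mp h2
    -- The extra exponent `2 * (r ⬝ᵥ w).val` cancels the sign that appears when the product is put
    -- in normal form.
    refine ⟨r, hr, w, hw, _, _, _, _, _, _, _, _, (piPerm_blocks x).symm ▸ hx,
      (piPerm_blocks x').symm ▸ hx', ?_, n + 2 * (r ⬝ᵥ w).val,
      leftOp (leftChecks C₁ C₂ U) * rightOp (rightChecks C₁ C₂ T), ?_, ?_⟩
    · rw [piPerm_blocks, piPerm_blocks]
      by_contra hc
      push Not at hc
      obtain ⟨rfl, rfl, rfl, rfl⟩ := hc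
      refine hne ⟨?_, ?_⟩ <;> rw [sumElim_zero, add_zero] <;> exact ⟨_, rfl⟩
    · exact ((isFrameStabilizer_xyz C₁ C₂).mem_iff _).mpr ⟨_, ⟨U, rfl⟩, _, ⟨T, rfl⟩, rfl⟩
    · rw [logical_product_eq, piPerm_blocks, piPerm_blocks, leftOp_add, rightOp_add, pow_add]
      -- To split off the stabilizer element, the left cycle must pass the right check, and the two
      -- are orthogonal.
      have hc := commute_leftOp_rightOp
        ((h.orthogonal hx hw hx' hr).1 T)
      have hp := phase_pow_commute (2 * (r ⬝ᵥ w).val)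
        (leftOp (leftChecks C₁ C₂ U) * rightOp (rightChecks C₁ C₂ T))
      rw [mul_assoc _ (leftOp _ * rightOp _), ← hp.left_comm, mul_assoc (phase _ ^ n),
        ← mul_assoc (phase _ ^ (2 * (r ⬝ᵥ w).val)), phase_pow_two_mul_mul_self, one_mul]
      simp only [mul_assoc]
      rw [hc.left_comm]
  · rintro ⟨r, hr, w, hw, a₁, a₂, b₁, b₂, c₁, d₁, c₂, d₂, hab, hcd, hne, n, g, hg, rfl⟩
    have hS := isStabilizerCode_xyz C₁ C₂
    have h1 : IsLogical (xyzStabilizer C₁ C₂)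
        (leftOp (Sum.elim (piPerm a₁ a₂ b₁ b₂) w) *
          rightOp (Sum.elim (piPerm c₁ d₁ c₂ d₂) r)) :=
      h.isLogical hab hw hcd hr (by tauto)
    have h2 := h1.phase_mul_mul hS.le_pauliGroup hS.commute (2 * (r ⬝ᵥ w).val) (one_mem _)
    rw [mul_one] at h2
    rw [logical_product_eq]
    exact h2.phase_mul_mul hS.le_pauliGroup hS.commute n hg

end Completeness

/-! ### Dual families and anticommuting pairs. -/

section Pairs

theorem mul_dotProduct_mul {ι κ : Type} [Fintype ι] [Fintype κ] (x x' : ι → ZMod 2)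
    (y y' : κ → ZMod 2) :
    (fun p : ι × κ => x p.1 * y p.2) ⬝ᵥ (fun p => x' p.1 * y' p.2) = (x ⬝ᵥ x') * (y ⬝ᵥ y') := by
  simp only [dotProduct, Fintype.sum_prod_type, Finset.sum_mul_sum]
  exact Finset.sum_congr rfl fun i _ => Finset.sum_congr rfl fun j _ => by ring

theorem mul_mem_tensorSub {ι κ : Type} {U : Submodule (ZMod 2) (ι → ZMod 2)}
    {V : Submodule (ZMod 2) (κ → ZMod 2)} {x : ι → ZMod 2} {y : κ → ZMod 2} (hx : x ∈ U)
    (hy : y ∈ V) : (fun p => x p.1 * y p.2) ∈ tensorSub U V :=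
  Submodule.subset_span ⟨x, hx, y, hy, rfl⟩

theorem mem_ker_transpose_of_orthogonal {ι κ : Type} [Fintype ι] [Fintype κ]
    (H : Matrix ι κ (ZMod 2)) {e : ι → ZMod 2}
    (he : ∀ u ∈ LinearMap.range H.mulVecLin, e ⬝ᵥ u = 0) :
    e ∈ LinearMap.ker H.transpose.mulVecLin := by
  classical
  rw [LinearMap.mem_ker, Matrix.mulVecLin_apply, Matrix.mulVec_transpose]
  funext k
  have h := he _ ⟨Pi.single k 1, rfl⟩
  rw [Matrix.mulVecLin_apply, Matrix.dotProduct_mulVec] at h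
  simpa using h

/-- Dual families of `p * q` tensor products, from dual families of `p` and of `q` vectors. -/
theorem tensor_dual {ι κ : Type} [Fintype ι] [Fintype κ] {p q : ℕ} {e f : Fin p → ι → ZMod 2}
    {e' f' : Fin q → κ → ZMod 2} (h : ∀ i j, e i ⬝ᵥ f j = if i = j then 1 else 0)
    (h' : ∀ i j, e' i ⬝ᵥ f' j = if i = j then 1 else 0) (i j : Fin (p * q)) :
    (fun s : ι × κ => e (finProdFinEquiv.symm i).1 s.1 * e' (finProdFinEquiv.symm i).2 s.2) ⬝ᵥ
      (fun s => f (finProdFinEquiv.symm j).1 s.1 * f' (finProdFinEquiv.symm j).2 s.2) =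
      if i = j then 1 else 0 := by
  have e : i = j ↔ (finProdFinEquiv.symm i).1 = (finProdFinEquiv.symm j).1 ∧
      (finProdFinEquiv.symm i).2 = (finProdFinEquiv.symm j).2 := by
    rw [← Prod.ext_iff, finProdFinEquiv.symm.injective.eq_iff]
  simp only [mul_dotProduct_mul, h, h', e, ite_and, mul_ite, mul_one, mul_zero]
  split_ifs <;> rfl

/-- Dual bases of the kernel of `Hᵀ` and a complement of the range of `H`. -/
theorem exists_dual_bases {ι κ : Type} [Fintype ι] [Fintype κ] (H : Matrix ι κ (ZMod 2))
    {K W : Submodule (ZMod 2) (ι → ZMod 2)} (hK : K = LinearMap.ker H.transpose.mulVecLin)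
    (h : IsCompl W (LinearMap.range H.mulVecLin))
    (b : Module.Basis (Fin (Module.finrank (ZMod 2) W)) (ZMod 2) W) :
    ∃ (σ : Fin (Module.finrank (ZMod 2) K) → Fin (Module.finrank (ZMod 2) W))
      (e : Fin (Module.finrank (ZMod 2) K) → ι → ZMod 2), (∀ i, e i ∈ K) ∧
      ∀ i j, e i ⬝ᵥ (b (σ j) : ι → ZMod 2) = if i = j then 1 else 0 := by
  subst hK
  obtain ⟨e, he, hd⟩ := exists_dual_family h b
  -- Both index sets have the same size, so the casts identify them and the duality is with the
  -- whole basis `b`.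
  have hσ := finrank_ker_transpose_of_isCompl H h
  refine ⟨Fin.cast hσ.symm, fun i => e (Fin.cast hσ.symm i),
    fun i => mem_ker_transpose_of_orthogonal H (he _), fun i j => ?_⟩
  rw [hd]
  simp

variable {m₁ m₂ m₃ m₄ nA nB : ℕ} {C₁ : CSSCode m₂ m₁ nA} {C₂ : CSSCode m₄ m₃ nB}
  {WA : Submodule (ZMod 2) (Fin nA → ZMod 2)} {WB : Submodule (ZMod 2) (Fin nB → ZMod 2)}
  {W₁ : Submodule (ZMod 2) (Fin m₁ ⊕ Fin m₂ → ZMod 2)}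
  {W₂ : Submodule (ZMod 2) (Fin m₄ ⊕ Fin m₃ → ZMod 2)}

theorem IsComplFamily.exists_first_pairs (h : IsComplFamily C₁ C₂ WA WB W₁ W₂) :
    ∃ r w : Fin (Module.finrank (ZMod 2) C₁.ker * Module.finrank (ZMod 2) C₂.ker) →
        Fin nA × Fin nB → ZMod 2,
      (∀ i, r i ∈ tensorSub C₁.ker WB) ∧ (∀ i, w i ∈ tensorSub WA C₂.ker) ∧
      ∀ i j, r i ⬝ᵥ w j = if i = j then 1 else 0 := by
  let bA := Module.finBasis (ZMod 2) WA
  let bB := Module.finBasis (ZMod 2) WB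
  -- The transpose is used because `WA` complements the image of `Hᵀ`, whose annihilator is `ker H`.
  obtain ⟨σ, e, he, hd⟩ := exists_dual_bases (Matrix.fromRows C₁.Hz C₁.Hx).transpose
    (K := C₁.ker) (by rw [Matrix.transpose_transpose, C₁.ker_eq_zx]) (C₁.imT_eq_zx ▸ h.left) bA
  obtain ⟨σ', e', he', hd'⟩ := exists_dual_bases (Matrix.fromRows C₂.Hx C₂.Hz).transpose
    (K := C₂.ker) (by rw [Matrix.transpose_transpose]; rfl) (C₂.imT_eq_xz ▸ h.right) bB
  refine ⟨_, _, fun i => ?_, fun i => ?_, tensor_dual hd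
    (fun i j => (dotProduct_comm _ _).trans ((hd' j i).trans (by simp [eq_comm])))⟩
  · exact mul_mem_tensorSub (he _) (bB _).2
  · exact mul_mem_tensorSub (bA _).2 (he' _)

/-- The vectors are pure tensors. When `W₂` or `W₁` is split, its basis vectors live on one block,
and a tensor product with such a vector vanishes on the other. -/
theorem IsComplFamily.exists_second_pairs (h : IsComplFamily C₁ C₂ WA WB W₁ W₂) :
    ∃ a c : Fin (Module.finrank (ZMod 2) C₁.kerTZX * Module.finrank (ZMod 2) C₂.kerTXZ) →
        (Fin m₁ ⊕ Fin m₂) × (Fin m₄ ⊕ Fin m₃) → ZMod 2,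
      (∀ i, a i ∈ tensorSub C₁.kerTZX W₂) ∧ (∀ i, c i ∈ tensorSub W₁ C₂.kerTXZ) ∧
      (∀ i j, a i ⬝ᵥ c j = if i = j then 1 else 0) ∧
      (IsBlockAdapted W₂ → ∀ i, (∀ k l, a i (k, Sum.inl l) = 0) ∨ ∀ k l, a i (k, Sum.inr l) = 0) ∧
      (IsBlockAdapted W₁ → ∀ i, (∀ k l, c i (Sum.inl k, l) = 0) ∨
        ∀ k l, c i (Sum.inr k, l) = 0) := by
  obtain ⟨b₁, hb₁⟩ := exists_basis_of_isBlockAdapted W₁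
  obtain ⟨b₂, hb₂⟩ := exists_basis_of_isBlockAdapted W₂
  obtain ⟨σ, e, he, hd⟩ := exists_dual_bases (Matrix.fromRows C₁.Hz C₁.Hx) C₁.kerTZX_eq h.leftT b₁
  obtain ⟨σ', e', he', hd'⟩ :=
    exists_dual_bases (Matrix.fromRows C₂.Hx C₂.Hz) C₂.kerTXZ_eq h.rightT b₂
  refine ⟨_, _, fun i => ?_, fun i => ?_, tensor_dual hd
    (fun i j => (dotProduct_comm _ _).trans ((hd' j i).trans (by simp [eq_comm]))),
    fun hW i => ?_, fun hW i => ?_⟩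
  · exact mul_mem_tensorSub (he _) (b₂ _).2
  · exact mul_mem_tensorSub (b₁ _).2 (he' _)
  · exact (hb₂ hW _).imp (fun h0 k l => by rw [h0, mul_zero]) fun h0 k l => by rw [h0, mul_zero]
  · exact (hb₁ hW _).imp (fun h0 k l => by rw [h0, zero_mul]) fun h0 k l => by rw [h0, zero_mul]

end Pairs

/-! ### Commutation of the separate halves, and assembly of the theorem. -/

section Main

variable {m₁ m₂ m₃ m₄ nA nB : ℕ} {C₁ : CSSCode m₂ m₁ nA} {C₂ : CSSCode m₄ m₃ nB}
  {WA : Submodule (ZMod 2) (Fin nA → ZMod 2)} {WB : Submodule (ZMod 2) (Fin nB → ZMod 2)}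
  {W₁ : Submodule (ZMod 2) (Fin m₁ ⊕ Fin m₂ → ZMod 2)}
  {W₂ : Submodule (ZMod 2) (Fin m₄ ⊕ Fin m₃ → ZMod 2)}

theorem commute_leftOp_of_orthogonal {z : HgpVec m₁ m₂ m₃ m₄ nA nB}
    (hz : ∀ T, z ⬝ᵥ rightChecks C₁ C₂ T = 0) : ∀ g ∈ xyzStabilizer C₁ C₂, Commute g (leftOp z) := by
  have h1 := ((isFrameStabilizer_xyz C₁ C₂).commute_iff 0 (toQubit z) (toQubit 0)).mpr
  rw [orthogonal_range_iff, orthogonal_range_iff] at h1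
  have h2 := h1 ⟨hz, fun U => zero_dotProduct _⟩
  rwa [pow_zero, one_mul, map_zero, frameOp_zero, mul_one] at h2

theorem commute_rightOp_of_orthogonal {z : HgpVec m₁ m₂ m₃ m₄ nA nB}
    (hz : ∀ U, z ⬝ᵥ leftChecks C₁ C₂ U = 0) : ∀ g ∈ xyzStabilizer C₁ C₂, Commute g (rightOp z) := by
  have h1 := ((isFrameStabilizer_xyz C₁ C₂).commute_iff 0 (toQubit 0) (toQubit z)).mpr
  rw [orthogonal_range_iff, orthogonal_range_iff] at h1
  have h2 := h1 ⟨fun T => zero_dotProduct _, hz⟩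
  rwa [pow_zero, one_mul, map_zero, frameOp_zero, one_mul] at h2

variable (C₁ C₂) in
-- With zero in block `C`, the cycle condition is only `Hᵀ X = 0` and restricts columns alone, so
-- any space, even `⊤`, may stand on the right.
theorem orthogonal_of_mem_kerTZX {x : (Fin m₁ ⊕ Fin m₂) × (Fin m₄ ⊕ Fin m₃) → ZMod 2}
    (hx : x ∈ tensorSub C₁.kerTZX ⊤) (T : Matrix (Fin nA) (Fin m₄ ⊕ Fin m₃) (ZMod 2)) :
    Sum.elim x 0 ⬝ᵥ rightChecks C₁ C₂ T = 0 := by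
  obtain ⟨X, rfl⟩ : ∃ X : Matrix (Fin m₁ ⊕ Fin m₂) (Fin m₄ ⊕ Fin m₃) (ZMod 2),
    x = Function.uncurry X := ⟨fun i j => x (i, j), rfl⟩
  rw [C₁.kerTZX_eq, uncurry_mem_tensorSub_ker_left] at hx
  have h := sumElim_dotProduct_hgpRight (Matrix.fromRows C₁.Hz C₁.Hx)
    (Matrix.fromRows C₂.Hx C₂.Hz) X 0 T
  rw [hx.1, Matrix.zero_mul, add_zero, Matrix.transpose_zero, Matrix.zero_mul,
    Matrix.trace_zero] at h
  exact h

variable (C₁ C₂) in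
theorem orthogonal_of_mem_kerTXZ {x : (Fin m₁ ⊕ Fin m₂) × (Fin m₄ ⊕ Fin m₃) → ZMod 2}
    (hx : x ∈ tensorSub ⊤ C₂.kerTXZ) (U : Matrix (Fin m₁ ⊕ Fin m₂) (Fin nB) (ZMod 2)) :
    Sum.elim x 0 ⬝ᵥ leftChecks C₁ C₂ U = 0 := by
  obtain ⟨X, rfl⟩ : ∃ X : Matrix (Fin m₁ ⊕ Fin m₂) (Fin m₄ ⊕ Fin m₃) (ZMod 2),
    x = Function.uncurry X := ⟨fun i j => x (i, j), rfl⟩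
  rw [C₂.kerTXZ_eq, uncurry_mem_tensorSub_ker_right, Matrix.transpose_transpose] at hx
  have h := sumElim_dotProduct_hgpLeft (Matrix.fromRows C₁.Hz C₁.Hx)
    (Matrix.fromRows C₂.Hx C₂.Hz) X 0 U
  rw [hx.2, Matrix.mul_zero, add_zero, Matrix.transpose_zero, Matrix.zero_mul,
    Matrix.trace_zero] at h
  exact h

theorem isBlockAdapted_top {α β : Type} :
    IsBlockAdapted (⊤ : Submodule (ZMod 2) (α ⊕ β → ZMod 2)) := fun _ _ => Submodule.mem_top

/-- Enlarging `W₂` to `⊤`, which is always split, keeps the columns in `ker Hᵀ`; so each half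
commutes with the stabilizer even if `W₂` is not split. -/
theorem commute_opXL2_opXL3 {a₁ : Fin m₁ × Fin m₄ → ZMod 2} {a₂ : Fin m₁ × Fin m₃ → ZMod 2}
    {b₁ : Fin m₂ × Fin m₄ → ZMod 2} {b₂ : Fin m₂ × Fin m₃ → ZMod 2}
    (hab : piPerm a₁ a₂ b₁ b₂ ∈ tensorSub C₁.kerTZX W₂) :
    ∀ g ∈ xyzStabilizer C₁ C₂, Commute g (opXL2 a₁ b₁) ∧ Commute g (opXL3 a₂ b₂) := by
  have h1 : piPerm a₁ a₂ b₁ b₂ ∈ tensorSub C₁.kerTZX ⊤ :=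
    mem_tensorSub_iff.mpr ⟨(mem_tensorSub_iff.mp hab).1, fun _ => Submodule.mem_top⟩
  obtain ⟨h2, h3⟩ := piPerm_mem_right isBlockAdapted_top h1
  rw [opXL2_eq, opXL3_eq]
  exact fun g hg => ⟨commute_leftOp_of_orthogonal (orthogonal_of_mem_kerTZX C₁ C₂ h2) g hg,
    commute_leftOp_of_orthogonal (orthogonal_of_mem_kerTZX C₁ C₂ h3) g hg⟩

theorem commute_opZL2_opZL3 {c₁ : Fin m₁ × Fin m₄ → ZMod 2} {d₁ : Fin m₁ × Fin m₃ → ZMod 2}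
    {c₂ : Fin m₂ × Fin m₄ → ZMod 2} {d₂ : Fin m₂ × Fin m₃ → ZMod 2}
    (hcd : piPerm c₁ d₁ c₂ d₂ ∈ tensorSub W₁ C₂.kerTXZ) :
    ∀ g ∈ xyzStabilizer C₁ C₂, Commute g (opZL2 c₁ d₁) ∧ Commute g (opZL3 c₂ d₂) := by
  have h1 : piPerm c₁ d₁ c₂ d₂ ∈ tensorSub ⊤ C₂.kerTXZ :=
    mem_tensorSub_iff.mpr ⟨fun _ => Submodule.mem_top, (mem_tensorSub_iff.mp hcd).2⟩
  obtain ⟨h2, h3⟩ := piPerm_mem_left isBlockAdapted_top h1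
  rw [opZL2_eq, opZL3_eq]
  exact fun g hg => ⟨commute_rightOp_of_orthogonal (orthogonal_of_mem_kerTXZ C₁ C₂ h2) g hg,
    commute_rightOp_of_orthogonal (orthogonal_of_mem_kerTXZ C₁ C₂ h3) g hg⟩

theorem leftOp_commute (z z' : HgpVec m₁ m₂ m₃ m₄ nA nB) : Commute (leftOp z) (leftOp z') :=
  frameOp_commute_self _ _ _

theorem rightOp_commute (z z' : HgpVec m₁ m₂ m₃ m₄ nA nB) : Commute (rightOp z) (rightOp z') :=
  frameOp_commute_self _ _ _

theorem elim_dotProduct_elim_eq_zero (x : (Fin m₁ ⊕ Fin m₂) × (Fin m₄ ⊕ Fin m₃) → ZMod 2)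
    (y : Fin nA × Fin nB → ZMod 2) :
    (Sum.elim x 0 : HgpVec m₁ m₂ m₃ m₄ nA nB) ⬝ᵥ Sum.elim 0 y = 0 := by
  rw [sumElim_dotProduct_sumElim, dotProduct_zero, zero_dotProduct, add_zero]

theorem phase_pow_two_mul_val_ite {Q : Type} [Fintype Q] [DecidableEq Q] (p : Prop) [Decidable p] :
    phase Q ^ (2 * (if p then 1 else 0 : ZMod 2).val) = if p then -1 else 1 := by
  split_ifs
  · rw [ZMod.val_one, mul_one, phase_sq]
  · rw [ZMod.val_zero, mul_zero, pow_zero]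

theorem ne_zero_of_dual {ι J : Type} [Fintype ι] [DecidableEq J] {a c : J → ι → ZMod 2}
    (h : ∀ i j, a i ⬝ᵥ c j = if i = j then 1 else 0) (i : J) : a i ≠ 0 ∧ c i ≠ 0 := by
  have h1 := h i i
  rw [if_pos rfl] at h1
  constructor <;> intro h0 <;> simp [h0] at h1

theorem IsComplFamily.exists_anticommuting_pairs (h : IsComplFamily C₁ C₂ WA WB W₁ W₂) :
    ∃ X Z : Fin (Module.finrank (ZMod 2) C₁.ker * Module.finrank (ZMod 2) C₂.ker) ⊕
        Fin (Module.finrank (ZMod 2) C₁.kerTZX * Module.finrank (ZMod 2) C₂.kerTXZ) →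
        (QOp (Qubit m₁ m₂ m₃ m₄ nA nB))ˣ,
      (∀ i, ∃ r ∈ tensorSub C₁.ker WB, ∃ w ∈ tensorSub WA C₂.ker,
        X (Sum.inl i) = opXL r ∧ Z (Sum.inl i) = opZL w) ∧
      (∀ i, ∃ a₁ a₂ b₁ b₂ c₁ d₁ c₂ d₂,
        piPerm a₁ a₂ b₁ b₂ ∈ tensorSub C₁.kerTZX W₂ ∧
        piPerm c₁ d₁ c₂ d₂ ∈ tensorSub W₁ C₂.kerTXZ ∧
        X (Sum.inr i) = opXL2 a₁ b₁ * opXL3 a₂ b₂ ∧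
        Z (Sum.inr i) = opZL2 c₁ d₁ * opZL3 c₂ d₂ ∧
        (IsBlockAdapted W₂ → (a₁ = 0 ∧ b₁ = 0) ∨ (a₂ = 0 ∧ b₂ = 0)) ∧
        (IsBlockAdapted W₁ → (c₁ = 0 ∧ d₁ = 0) ∨ (c₂ = 0 ∧ d₂ = 0))) ∧
      (∀ i, IsLogical (xyzStabilizer C₁ C₂) (X i) ∧ IsLogical (xyzStabilizer C₁ C₂) (Z i)) ∧
      (∀ i j, Commute (X i) (X j) ∧ Commute (Z i) (Z j)) ∧
      (∀ i j, X i * Z j = (if i = j then -1 else 1) * (Z j * X i)) := by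
  obtain ⟨r, w, hr, hw, hrw⟩ := h.exists_first_pairs
  obtain ⟨a, c, ha, hc, hac, hW₂, hW₁⟩ := h.exists_second_pairs
  refine ⟨Sum.elim (fun i => rightOp (Sum.elim 0 (r i))) (fun i => leftOp (Sum.elim (a i) 0)),
    Sum.elim (fun i => leftOp (Sum.elim 0 (w i))) (fun i => rightOp (Sum.elim (c i) 0)),
    ?_, ?_, ?_, ?_, ?_⟩
  · exact fun i => ⟨r i, hr i, w i, hw i, (opXL_eq _).symm, (opZL_eq _).symm⟩
  · intro i
    refine ⟨_, _, _, _, _, _, _, _, (piPerm_blocks (a i)).symm ▸ ha i,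
      (piPerm_blocks (c i)).symm ▸ hc i, ?_, ?_, fun hW => ?_, fun hW => ?_⟩
    · rw [opXL2_mul_opXL3, piPerm_blocks]; rfl
    · rw [opZL2_mul_opZL3, piPerm_blocks]; rfl
    · exact (hW₂ hW i).imp (fun h0 => ⟨funext fun _ => h0 _ _, funext fun _ => h0 _ _⟩)
        fun h0 => ⟨funext fun _ => h0 _ _, funext fun _ => h0 _ _⟩
    · exact (hW₁ hW i).imp (fun h0 => ⟨funext fun _ => h0 _ _, funext fun _ => h0 _ _⟩)
        fun h0 => ⟨funext fun _ => h0 _ _, funext fun _ => h0 _ _⟩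
  · rintro (i | i)
    · have h0 := ne_zero_of_dual hrw i
      rw [Sum.elim_inl, Sum.elim_inl, ← opXL_eq, ← opZL_eq]
      exact ⟨h.isLogical_opXL (hr i) h0.1, h.isLogical_opZL (hw i) h0.2⟩
    · have h0 := ne_zero_of_dual hac i
      exact ⟨h.isLogical_leftOp (ha i) h0.1, h.isLogical_rightOp (hc i) h0.2⟩
  -- Operators of the two types have disjoint supports: block `C` against the other four blocks.
  · have h1 : ∀ x y, Commute (leftOp (Sum.elim x 0 : HgpVec m₁ m₂ m₃ m₄ nA nB))
        (rightOp (Sum.elim 0 y)) :=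
      fun x y => commute_leftOp_rightOp (elim_dotProduct_elim_eq_zero x y)
    have h2 : ∀ x y, Commute (leftOp (Sum.elim 0 y : HgpVec m₁ m₂ m₃ m₄ nA nB))
        (rightOp (Sum.elim x 0)) :=
      fun x y => commute_leftOp_rightOp
        ((dotProduct_comm _ _).trans (elim_dotProduct_elim_eq_zero x y))
    rintro (i | i) (j | j)
    · exact ⟨rightOp_commute _ _, leftOp_commute _ _⟩
    · exact ⟨(h1 _ _).symm, h2 _ _⟩
    · exact ⟨h1 _ _, (h2 _ _).symm⟩
    · exact ⟨leftOp_commute _ _, rightOp_commute _ _⟩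
  · rintro (i | i) (j | j)
    · rw [Sum.elim_inl, Sum.elim_inl, rightOp_mul_leftOp, sumElim_dotProduct_sumElim,
        zero_dotProduct, zero_add, hrw, phase_pow_two_mul_val_ite]
      simp only [Sum.inl.injEq]
    -- In the mixed cases `X i` and `Z j` are strings of the same side of the frame, so they
    -- commute.
    · rw [if_neg Sum.inl_ne_inr, one_mul]
      exact rightOp_commute _ _
    · rw [if_neg Sum.inr_ne_inl, one_mul]
      exact leftOp_commute _ _
    · rw [Sum.elim_inr, Sum.elim_inr, leftOp_mul_rightOp, sumElim_dotProduct_sumElim,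
        zero_dotProduct, add_zero, hac, phase_pow_two_mul_val_ite]
      simp only [Sum.inr.injEq]

end Main

theorem theorem2 {m₁ m₂ m₃ m₄ nA nB : ℕ}
    (C₁ : CSSCode m₂ m₁ nA) (C₂ : CSSCode m₄ m₃ nB)
    (WA : Submodule (ZMod 2) (Fin nA → ZMod 2)) (hWA : IsCompl WA C₁.imT)
    (WB : Submodule (ZMod 2) (Fin nB → ZMod 2)) (hWB : IsCompl WB C₂.imT)
    (W₁ : Submodule (ZMod 2) (Fin m₁ ⊕ Fin m₂ → ZMod 2)) (hW₁ : IsCompl W₁ C₁.imZX)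
    (W₂ : Submodule (ZMod 2) (Fin m₄ ⊕ Fin m₃ → ZMod 2)) (hW₂ : IsCompl W₂ C₂.imXZ) :
    let S : Subgroup (QOp (Qubit m₁ m₂ m₃ m₄ nA nB))ˣ := xyzStabilizer C₁ C₂
    let k₁ : ℕ := Module.finrank (ZMod 2) C₁.ker * Module.finrank (ZMod 2) C₂.ker
    let k₂ : ℕ := Module.finrank (ZMod 2) C₁.kerTZX * Module.finrank (ZMod 2) C₂.kerTXZ
    -- first type
    (∀ r ∈ tensorSub C₁.ker WB, r ≠ 0 → IsLogical S (opXL r)) ∧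
    (∀ w ∈ tensorSub WA C₂.ker, w ≠ 0 → IsLogical S (opZL w)) ∧
    -- second type, `X` half
    (∀ a₁ a₂ b₁ b₂, piPerm a₁ a₂ b₁ b₂ ∈ tensorSub C₁.kerTZX W₂ →
      (∀ g ∈ S, Commute g (opXL2 a₁ b₁) ∧ Commute g (opXL3 a₂ b₂)) ∧
      (piPerm a₁ a₂ b₁ b₂ ≠ 0 → IsLogical S (opXL2 a₁ b₁ * opXL3 a₂ b₂)) ∧
      (IsBlockAdapted W₂ →
        ((a₁ ≠ 0 ∨ b₁ ≠ 0) → IsLogical S (opXL2 a₁ b₁)) ∧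
        ((a₂ ≠ 0 ∨ b₂ ≠ 0) → IsLogical S (opXL3 a₂ b₂)))) ∧
    -- second type, `Z` half
    (∀ c₁ d₁ c₂ d₂, piPerm c₁ d₁ c₂ d₂ ∈ tensorSub W₁ C₂.kerTXZ →
      (∀ g ∈ S, Commute g (opZL2 c₁ d₁) ∧ Commute g (opZL3 c₂ d₂)) ∧
      (piPerm c₁ d₁ c₂ d₂ ≠ 0 → IsLogical S (opZL2 c₁ d₁ * opZL3 c₂ d₂)) ∧
      (IsBlockAdapted W₁ →
        ((c₁ ≠ 0 ∨ d₁ ≠ 0) → IsLogical S (opZL2 c₁ d₁)) ∧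
        ((c₂ ≠ 0 ∨ d₂ ≠ 0) → IsLogical S (opZL3 c₂ d₂)))) ∧
    -- complements adapted to the blocks exist
    (∃ W, IsCompl W C₁.imZX ∧ IsBlockAdapted W) ∧
    (∃ W, IsCompl W C₂.imXZ ∧ IsBlockAdapted W) ∧
    -- up to phases and stabilizers, the logical operators are the nontrivial products of the two
    -- types
    (∀ P, IsLogical S P ↔
      ∃ r ∈ tensorSub C₁.ker WB, ∃ w ∈ tensorSub WA C₂.ker, ∃ a₁ a₂ b₁ b₂ c₁ d₁ c₂ d₂,
        piPerm a₁ a₂ b₁ b₂ ∈ tensorSub C₁.kerTZX W₂ ∧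
        piPerm c₁ d₁ c₂ d₂ ∈ tensorSub W₁ C₂.kerTXZ ∧
        (r ≠ 0 ∨ w ≠ 0 ∨ piPerm a₁ a₂ b₁ b₂ ≠ 0 ∨ piPerm c₁ d₁ c₂ d₂ ≠ 0) ∧
        ∃ (n : ℕ), ∃ g ∈ S, P = phase _ ^ n * g * (opXL r * opZL w *
          (opXL2 a₁ b₁ * opXL3 a₂ b₂) * (opZL2 c₁ d₁ * opZL3 c₂ d₂))) ∧
    -- `k₁` pairs of the first type and `k₂` pairs of the second type
    (∃ X Z : Fin k₁ ⊕ Fin k₂ → (QOp (Qubit m₁ m₂ m₃ m₄ nA nB))ˣ,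
      (∀ i, ∃ r ∈ tensorSub C₁.ker WB, ∃ w ∈ tensorSub WA C₂.ker,
        X (Sum.inl i) = opXL r ∧ Z (Sum.inl i) = opZL w) ∧
      (∀ i, ∃ a₁ a₂ b₁ b₂ c₁ d₁ c₂ d₂,
        piPerm a₁ a₂ b₁ b₂ ∈ tensorSub C₁.kerTZX W₂ ∧
        piPerm c₁ d₁ c₂ d₂ ∈ tensorSub W₁ C₂.kerTXZ ∧
        X (Sum.inr i) = opXL2 a₁ b₁ * opXL3 a₂ b₂ ∧
        Z (Sum.inr i) = opZL2 c₁ d₁ * opZL3 c₂ d₂ ∧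
        (IsBlockAdapted W₂ → (a₁ = 0 ∧ b₁ = 0) ∨ (a₂ = 0 ∧ b₂ = 0)) ∧
        (IsBlockAdapted W₁ → (c₁ = 0 ∧ d₁ = 0) ∨ (c₂ = 0 ∧ d₂ = 0))) ∧
      (∀ i, IsLogical S (X i) ∧ IsLogical S (Z i)) ∧
      (∀ i j, Commute (X i) (X j) ∧ Commute (Z i) (Z j)) ∧
      (∀ i j, X i * Z j = (if i = j then -1 else 1) * (Z j * X i))) ∧
    -- the total number of pairs is the code dimension
    IsStabilizerCode S (k₁ + k₂) ∧
    ((k₁ + k₂ : ℕ) : ℤ) = ((nA : ℤ) - m₁ - m₂) * ((nB : ℤ) - m₃ - m₄)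
      + Module.finrank (ZMod 2) (tensorSub C₁.kerTZX C₂.ker)
      + Module.finrank (ZMod 2) (tensorSub C₁.ker C₂.kerTXZ) := by
  intro S k₁ k₂
  have h : IsComplFamily C₁ C₂ WA WB W₁ W₂ := ⟨hWA, hWB, hW₁, hW₂⟩
  refine ⟨fun r hr h0 => h.isLogical_opXL hr h0, fun w hw h0 => h.isLogical_opZL hw h0, ?_, ?_,
    exists_isCompl_isBlockAdapted _, exists_isCompl_isBlockAdapted _, h.isLogical_iff_exists,
    h.exists_anticommuting_pairs, isStabilizerCode_xyz C₁ C₂, dimension_eq C₁ C₂⟩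
  · intro a₁ a₂ b₁ b₂ hab
    refine ⟨fun g hg => ?_, fun h0 => ?_, fun hW => ⟨fun h0 => ?_, fun h0 => ?_⟩⟩
    · exact commute_opXL2_opXL3 hab g hg
    · rw [opXL2_mul_opXL3]
      exact h.isLogical_leftOp hab h0
    · rw [opXL2_eq]
      refine h.isLogical_leftOp (piPerm_mem_right hW hab).1 fun h1 => ?_
      rw [piPerm_eq_zero_iff] at h1
      tauto
    · rw [opXL3_eq]
      refine h.isLogical_leftOp (piPerm_mem_right hW hab).2 fun h1 => ?_
      rw [piPerm_eq_zero_iff] at h1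
      tauto
  · intro c₁ d₁ c₂ d₂ hcd
    refine ⟨fun g hg => ?_, fun h0 => ?_, fun hW => ⟨fun h0 => ?_, fun h0 => ?_⟩⟩
    · exact commute_opZL2_opZL3 hcd g hg
    · rw [opZL2_mul_opZL3]
      exact h.isLogical_rightOp hcd h0
    · rw [opZL2_eq]
      refine h.isLogical_rightOp (piPerm_mem_left hW hcd).1 fun h1 => ?_
      rw [piPerm_eq_zero_iff] at h1
      tauto
    · rw [opZL3_eq]
      refine h.isLogical_rightOp (piPerm_mem_left hW hcd).2 fun h1 => ?_
      rw [piPerm_eq_zero_iff] at h1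
      tauto
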